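/- A \emph{Boolean frame} is an algebra $\mathfrak A=\langle A,\sqcap,-,0,f\rangle$ where $\langle A,\sqcap,-,0\rangle$ is a (possibly one-element) Boolean algebra and $f:A\to A$ is an arbitrary unary operation. A \emph{variety} is an equational class of Boolean frames; varieties form a lattice under inclusion, with $\mathbf V\wedge\mathbf W=\mathbf V\cap\mathbf W$ and $\mathbf V\vee\mathbf W$ the class of models of the equations valid in both, and $\mathbf V(\mathfrak A)$ is the variety generated by $\mathfrak A$. Let $\mathsf L_{f(0)=0}$ (resp. $\mathsf L_{f(1)=1}$) be the lattice of varieties in which $f(0)=0$ (resp. $f(1)=1$) holds; the former varieties are called \emph{normal}. A variety is \emph{strongly non-additive} if it is not the case that every member $(A,f)$ is term-equivalent, over the Boolean operations, to some $(A,g)$ with $g(x\sqcup y)=g(x)\sqcup g(y)$ for all $x,y$ (the terms may depend on the member). A variety has the \emph{CEP} if every congruence of a subalgebra of a member is the restriction of a congruence of that member; it has \emph{EDPC} if there are finitely many pairs of quaternary terms $p_i,q_i$ such that in every member $(c,d)\in\operatorname{Cg}(a,b)$ iff $p_i(a,b,c,d)=q_i(a,b,c,d)$ for all $i$; it is a \emph{discriminator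 variety} if some ternary term $t$ satisfies, on all its subdirectly irreducible members, $t(a,b,c)=a$ if $a\ne b$ and $t(a,b,c)=c$ if $a=b$. A \emph{congruential modal logic} $L$ is a set of formulas (built from variables by $\wedge,\neg,\bot,\Diamond$) that contains all classical tautologies and is closed under substitution, modus ponens and the rule $\varphi\leftrightarrow\psi\,/\,\Diamond\varphi\leftrightarrow\Diamond\psi$; $\Gamma\vdash_L\varphi$ means that $\varphi$ is derivable from $L\cup\Gamma$ by modus ponens and this rule. $L$ has the \emph{(global) deduction--detachment theorem} (DDT) if there is a finite set $\Delta(p,q)$ of formulas in two variables with: $\Gamma,\varphi\vdash_L\psi$ iff $\Gamma\vdash_L\Delta(\varphi,\psi)$, for all $\Gamma,\varphi,\psi$; it has the \emph{local} DDT (LDDT) if there is a family $\mathcal F$ of such finite sets with: $\Gamma,\varphi\vdash_L\psi$ iff $\Gamma\vdash_L\Delta(\varphi,\psi)$ for some $\Delta\in\mathcal F$. The variety $\mathbf V_L$ of $L$ is axiomatized by the equations $\varphi=1$, $\varphi\in L$ (with $\Diamond$ read as $f$). $L$ is \emph{strongly non-additive} if $\mathbf V_L$ is, and \emph{normal} if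 $\Diamond\bot\leftrightarrow\bot\in L$. For $n\ge 3$ put $n=\{0,\dots,n-1\}$, and let $\mathfrak A_n=(\mathfrak P(n),f)$ where $$\emptyset\mapsto n\mapsto\{n-1\}\mapsto\{n-2\}\mapsto\cdots\mapsto\{0\}\mapsto\emptyset$$ and $f(x)=x$ for all other $x$; let $\mathfrak A_n'=(\mathfrak P(n),f')$ where $$\emptyset\mapsto\{0\}\mapsto\{1\}\mapsto\cdots\mapsto\{n-1\}\mapsto n\mapsto\emptyset$$ and $f'(x)=x$ for all other $x$. \textbf{Theorem.} Let $n\ge 3$. (1) The map $\mathbf T(\mathbf W)=\mathbf W\vee\mathbf V(\mathfrak A_n)$ is an injective lattice homomorphism from $\mathsf L_{f(0)=0}$ into the lattice of varieties of Boolean frames, and for every normal variety $\mathbf W$ the variety $\mathbf T(\mathbf W)$ is strongly non-additive; if $\mathbf W$ has the CEP, has EDPC, or is a discriminator variety, then so has (is) $\mathbf T(\mathbf W)$. (2) There is an injective map $R$ from normal modal logics to congruential modal logics such that, for every normal modal logic $L$: $R(L)\subseteq L$ (so $L$ is an axiomatic extension of $R(L)$); $\mathbf V_{R(L)}=\mathbf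 V_L\vee\mathbf V(\mathfrak A_n)$; $R(L)$ is strongly non-additive; if $L$ has the LDDT, so has $R(L)$; and if $L$ has the DDT, so has $R(L)$. (3) The same as (1) and (2) holds with $f(1)=1$ in place of $f(0)=0$, with $\Diamond\top\leftrightarrow\top\in L$ in place of normality, and with $\mathfrak A_n'$ in place of $\mathfrak A_n$. -/

import Mathlib

universe u v

namespace BF

/-! ### Terms and Boolean frames -/

/-- Terms in the signature `⊓, ᶜ, ⊥, f` of Boolean frames, with variables from `X`. Terms over `ℕ`
are at the same time the formulas of modal logic (`op` is the modal operator). -/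
inductive BTerm (X : Type) : Type
  | var (x : X) : BTerm X
  | bot : BTerm X
  | compl (s : BTerm X) : BTerm X
  | inf (s t : BTerm X) : BTerm X
  | op (s : BTerm X) : BTerm X

namespace BTerm

variable {X Y : Type}

def top : BTerm X := compl bot

/-- Implication, `¬ (s ∧ ¬ t)`. -/
def imp (s t : BTerm X) : BTerm X := compl (inf s (compl t))

def iff (s t : BTerm X) : BTerm X := inf (imp s t) (imp t s)

/-- The term operation of a term in the algebra `(A, ⊓, ᶜ, ⊥, f)`. -/
def eval {A : Type u} [BooleanAlgebra A] (f : A → A) (e : X → A) : BTerm X → A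
  | var x => e x
  | bot => ⊥
  | compl s => (eval f e s)ᶜ
  | inf s t => eval f e s ⊓ eval f e t
  | op s => f (eval f e s)

/-- Simultaneous substitution. -/
def subst (σ : X → BTerm Y) : BTerm X → BTerm Y
  | var x => σ x
  | bot => bot
  | compl s => compl (subst σ s)
  | inf s t => inf (subst σ s) (subst σ t)
  | op s => op (subst σ s)

end BTerm

/-- A Boolean frame: a Boolean algebra with an arbitrary unary operation. -/
structure BFrame : Type (u + 1) where
  carrier : Type u
  [boolean : BooleanAlgebra carrier]
  op : carrier → carrier

attribute [instance] BFrame.boolean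

/-- An equation between two terms. -/
abbrev Equation : Type := BTerm ℕ × BTerm ℕ

def BFrame.Satisfies (A : BFrame.{u}) (E : Equation) : Prop :=
  ∀ e : ℕ → A.carrier, E.1.eval A.op e = E.2.eval A.op e

/-- The class of all Boolean frames satisfying a set of equations. -/
def models (E : Set Equation) : Set BFrame.{u} := {A | ∀ p ∈ E, A.Satisfies p}

/-- The equations valid in a class of Boolean frames. -/
def theory (K : Set BFrame.{u}) : Set Equation := {p | ∀ A ∈ K, A.Satisfies p}

theorem subset_models_iff (K : Set BFrame.{u}) (E : Set Equation) :
    K ⊆ models E ↔ E ⊆ theory K :=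
  ⟨fun h _ hp _ hA => h hA _ hp, fun h _ hA _ hp => h hp _ hA⟩

/-! ### The lattice of varieties -/

/-- A variety (equational class) of Boolean frames. -/
structure Variety : Type (u + 1) where
  members : Set BFrame.{u}
  equational : ∃ E : Set Equation, members = models E

namespace Variety

theorem members_injective : Function.Injective Variety.members.{u} := by
  rintro ⟨K, hK⟩ ⟨K', hK'⟩ h
  cases h
  rfl

/-- Varieties are ordered by inclusion. -/
instance : PartialOrder Variety.{u} where
  le V W := V.members ⊆ W.members
  le_refl V := Set.Subset.refl V.members
  le_trans V W U h₁ h₂ := Set.Subset.trans h₁ h₂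
  le_antisymm V W h₁ h₂ := members_injective (Set.Subset.antisymm h₁ h₂)

/-- The variety axiomatized by a set of equations. -/
def ofEquations (E : Set Equation) : Variety.{u} := ⟨models E, E, rfl⟩

/-- The lattice of varieties: the join of two varieties is the class of all models of their common
equations, the meet is the intersection. -/
instance : Lattice Variety.{u} where
  sup V W := ofEquations (theory (V.members ∪ W.members))
  inf V W := ⟨V.members ∩ W.members, by
    obtain ⟨E, hE⟩ := V.equational
    obtain ⟨F, hF⟩ := W.equational
    refine ⟨E ∪ F, ?_⟩
    rw [hE, hF]
    ext A
    constructor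
    · rintro ⟨h₁, h₂⟩ p (hp | hp)
      exacts [h₁ p hp, h₂ p hp]
    · intro h
      exact ⟨fun p hp => h p (Or.inl hp), fun p hp => h p (Or.inr hp)⟩⟩
  le_sup_left V W := fun A hA p hp => hp A (Or.inl hA)
  le_sup_right V W := fun A hA p hp => hp A (Or.inr hA)
  sup_le V W U h₁ h₂ := by
    obtain ⟨E, hE⟩ := U.equational
    intro A hA
    rw [hE]
    intro p hp
    refine hA p fun B hB => ?_
    have hBU : B ∈ U.members := by
      rcases hB with hB | hB
      exacts [h₁ hB, h₂ hB]
    rw [hE] at hBU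
    exact hBU p hp
  inf_le_left V W := fun A hA => hA.1
  inf_le_right V W := fun A hA => hA.2
  le_inf V W U h₁ h₂ := fun A hA => ⟨h₁ hA, h₂ hA⟩

/-- The variety generated by a Boolean frame `A`: all models of the equations valid in `A`.
The universe of its members is independent of that of `A`. -/
def generatedBy (A : BFrame.{v}) : Variety.{u} := ofEquations (theory {A})

/-- The variety of normal Boolean frames, `f(0) = 0`. -/
def normal : Variety.{u} := ofEquations {(BTerm.op BTerm.bot, BTerm.bot)}

/-- The variety of Boolean frames with `f(1) = 1`. -/
def unital : Variety.{u} := ofEquations {(BTerm.op BTerm.top, BTerm.top)}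

end Variety

/-! ### Subalgebras, congruences, and properties of varieties -/

/-- Congruences of a Boolean frame. -/
structure Congruence (A : BFrame.{u}) where
  rel : A.carrier → A.carrier → Prop
  equivalence : Equivalence rel
  inf : ∀ {a b c d}, rel a b → rel c d → rel (a ⊓ c) (b ⊓ d)
  compl : ∀ {a b}, rel a b → rel aᶜ bᶜ
  op : ∀ {a b}, rel a b → rel (A.op a) (A.op b)

/-- `(c, d)` belongs to the congruence of `A` generated by `(a, b)`. -/
def PrincipalCongruence (A : BFrame.{u}) (a b c d : A.carrier) : Prop :=
  ∀ θ : Congruence A, θ.rel a b → θ.rel c d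

/-- Subalgebras of a Boolean frame. -/
structure SubFrame (A : BFrame.{u}) where
  toSubalgebra : BooleanSubalgebra A.carrier
  op_mem : ∀ a ∈ toSubalgebra, A.op a ∈ toSubalgebra

/-- A subalgebra as a Boolean frame in its own right. -/
def SubFrame.frame {A : BFrame.{u}} (B : SubFrame A) : BFrame.{u} where
  carrier := B.toSubalgebra
  op a := ⟨A.op a.1, B.op_mem a.1 a.2⟩

/-- The congruence extension property of a single Boolean frame. -/
def BFrame.CEP (A : BFrame.{u}) : Prop :=
  ∀ (B : SubFrame A) (θ : Congruence B.frame), ∃ ψ : Congruence A,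
    ∀ x y : B.toSubalgebra, θ.rel x y ↔ ψ.rel x.1 y.1

/-- A subdirectly irreducible algebra: there is a least congruence among those different from the
identity. -/
def BFrame.SubdirectlyIrreducible (A : BFrame.{u}) : Prop :=
  ∃ μ : Congruence A, (∃ x y, μ.rel x y ∧ x ≠ y) ∧
    ∀ θ : Congruence A, (∃ x y, θ.rel x y ∧ x ≠ y) → ∀ x y, μ.rel x y → θ.rel x y

/-- `A` is term-equivalent, over the Boolean operations, to `(A, g)` for some additive `g`:
each of `f` and `g` is a term operation of the other algebra. -/
def BFrame.EquivalentToAdditive (A : BFrame.{u}) : Prop :=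
  ∃ g : A.carrier → A.carrier, (∀ x y, g (x ⊔ y) = g x ⊔ g y) ∧
    (∃ σ : BTerm Unit, ∀ x, σ.eval A.op (fun _ => x) = g x) ∧
    (∃ τ : BTerm Unit, ∀ x, τ.eval g (fun _ => x) = A.op x)

namespace Variety

/-- The congruence extension property. -/
def CEP (V : Variety.{u}) : Prop := ∀ A ∈ V.members, A.CEP

/-- Equationally definable principal congruences. -/
def EDPC (V : Variety.{u}) : Prop :=
  ∃ (n : ℕ) (p q : Fin n → BTerm (Fin 4)), ∀ A ∈ V.members, ∀ a b c d : A.carrier,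
    PrincipalCongruence A a b c d ↔
      ∀ i, (p i).eval A.op ![a, b, c, d] = (q i).eval A.op ![a, b, c, d]

/-- There is a term that is a discriminator term on all subdirectly irreducible members. -/
def IsDiscriminator (V : Variety.{u}) : Prop :=
  ∃ t : BTerm (Fin 3), ∀ A ∈ V.members, A.SubdirectlyIrreducible → ∀ a b c : A.carrier,
    (a ≠ b → t.eval A.op ![a, b, c] = a) ∧ (a = b → t.eval A.op ![a, b, c] = c)

/-- A variety is strongly non-additive if it is not the case that each of its members is
term-equivalent to an additive Boolean frame. -/
def StronglyNonAdditive (V : Variety.{u}) : Prop :=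
  ¬ ∀ A ∈ V.members, A.EquivalentToAdditive

end Variety

/-! ### The cyclic-shift algebras -/

/-- `∅ ↦ n ↦ {n-1} ↦ {n-2} ↦ ⋯ ↦ {0} ↦ ∅` on the subsets of `n = {0, …, n-1}`, and `x ↦ x` on all
other subsets. -/
def cyclicOp (n : ℕ) (x : Finset (Fin n)) : Finset (Fin n) :=
  if x = ∅ then Finset.univ
  else if x = Finset.univ then Finset.univ.filter fun i => i.val + 1 = n
  else if x.card = 1 then Finset.univ.filter fun i => ∃ j ∈ x, i.val + 1 = j.val
  else x

/-- `∅ ↦ {0} ↦ {1} ↦ ⋯ ↦ {n-1} ↦ n ↦ ∅` on the subsets of `n = {0, …, n-1}`, and `x ↦ x` on all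
other subsets. -/
def reversedCyclicOp (n : ℕ) (x : Finset (Fin n)) : Finset (Fin n) :=
  if x = ∅ then Finset.univ.filter fun i => i.val = 0
  else if x = Finset.univ then ∅
  else if x.card = 1 then
    if ∃ j ∈ x, j.val + 1 = n then Finset.univ
    else Finset.univ.filter fun i => ∃ j ∈ x, i.val = j.val + 1
  else x

def cyclicFrame (n : ℕ) : BFrame.{0} where
  carrier := Finset (Fin n)
  op := cyclicOp n

def reversedCyclicFrame (n : ℕ) : BFrame.{0} where
  carrier := Finset (Fin n)
  op := reversedCyclicOp n

/-! ### Congruential modal logics -/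

/-- Modal formulas. -/
abbrev Form : Type := BTerm ℕ

/-- Instances of classical propositional tautologies: formulas that are true under every valuation
respecting the classical connectives (and treating formulas `op φ` as atoms). -/
def IsTautology (φ : Form) : Prop :=
  ∀ w : Form → Prop, ¬ w BTerm.bot → (∀ α, w (BTerm.compl α) ↔ ¬ w α) →
    (∀ α β, w (BTerm.inf α β) ↔ w α ∧ w β) → w φ

/-- A congruential modal logic, given by its set of theorems. -/
structure CongruentialLogic where
  theorems : Set Form
  tautology : ∀ φ, IsTautology φ → φ ∈ theorems
  modusPonens : ∀ φ ψ : Form, φ ∈ theorems → φ.imp ψ ∈ theorems → ψ ∈ theorems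
  congruence : ∀ φ ψ : Form, φ.iff ψ ∈ theorems → φ.op.iff ψ.op ∈ theorems
  substitution : ∀ (φ : Form) (σ : ℕ → Form), φ ∈ theorems → φ.subst σ ∈ theorems

namespace CongruentialLogic

/-- The (global) consequence relation of a logic: derivability from its theorems and the premises
`Γ` by modus ponens and the congruence rule. -/
inductive Derives (L : CongruentialLogic) (Γ : Set Form) : Form → Prop
  | thm {φ : Form} : φ ∈ L.theorems → Derives L Γ φ
  | hyp {φ : Form} : φ ∈ Γ → Derives L Γ φ
  | mp {φ ψ : Form} : Derives L Γ φ → Derives L Γ (φ.imp ψ) → Derives L Γ ψ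
  | re {φ ψ : Form} : Derives L Γ (φ.iff ψ) → Derives L Γ (φ.op.iff ψ.op)

/-- The (global) deduction-detachment theorem. -/
def DDT (L : CongruentialLogic) : Prop :=
  ∃ Δ : Finset (BTerm (Fin 2)), ∀ (Γ : Set Form) (φ ψ : Form),
    L.Derives (insert φ Γ) ψ ↔ ∀ δ ∈ Δ, L.Derives Γ (δ.subst ![φ, ψ])

/-- The local deduction-detachment theorem. -/
def LDDT (L : CongruentialLogic) : Prop :=
  ∃ F : Set (Finset (BTerm (Fin 2))), ∀ (Γ : Set Form) (φ ψ : Form),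
    L.Derives (insert φ Γ) ψ ↔ ∃ Δ ∈ F, ∀ δ ∈ Δ, L.Derives Γ (δ.subst ![φ, ψ])

/-- The variety that is the algebraic semantics of a logic: it is axiomatized by the equations
`φ = 1` for the theorems `φ`. -/
def variety (L : CongruentialLogic) : Variety.{u} :=
  Variety.ofEquations ((fun φ => (φ, BTerm.top)) '' L.theorems)

/-- The counterpart of `f(0) = 0`. -/
def IsNormal (L : CongruentialLogic) : Prop :=
  (BTerm.op BTerm.bot).iff BTerm.bot ∈ L.theorems

/-- The counterpart of `f(1) = 1`. -/
def IsUnital (L : CongruentialLogic) : Prop :=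
  (BTerm.op BTerm.top).iff BTerm.top ∈ L.theorems

end CongruentialLogic

end BF

/-!
The proof rests on a ground term `k` with the value `1` in the given varieties and the value `0` in
the frame `P` that is adjoined: `k = ¬ f(0)` for normal varieties and the cyclic frame, `k = f(1)`
for the varieties with `f(1) = 1` and the reversed cyclic frame.

If `k` separates two varieties `V` and `W` in this way, then every member `A` of `V ⊔ W` is the
direct product of its relativizations to `k` and to `¬ k`, and these belong to `V` and `W`. That
`x ↦ x ⊓ k` is a homomorphism is itself an equation valid in both varieties
(`BF.Variety.Separated.isFactor`), and an equation `s = t` of `V` gives the common equation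
`s ⊓ k = t ⊓ k`. Hence `V ↦ V ⊔ W` preserves meets and is injective. Congruences of `A` split
along the decomposition, so that the CEP, EDPC and being a discriminator variety pass from `V` and
`W` to `V ⊔ W`.

The variety generated by `P` has these properties because some unary term `d` satisfies `d(0) = 0`
and `d(x) = 1` for `x ≠ 0` in `P`. The equations that follow (`BF.IsClosureTerm`) say that the
congruences of any member of the variety are given by its `d`-closed ideals. In the two frames all
singletons are values of ground terms, and `d(x)` is the union over `i` of terms that test whether
`i ∈ x` (`BF.isTermOp_cyclicOp_memTest`, `BF.isTermOp_reversedCyclicOp_memTest`).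

On the side of logics, `R(L)` is the intersection of `L` with the logic of `P`. A derivation in `L`
becomes a derivation in `R(L)` when every formula `φ` in it is replaced by `k → φ`
(`BF.CongruentialLogic.Separated.derives_imp_iff`), so that the deduction sets of `L` and of the
logic of `P`, relativized to `k` and `¬ k`, combine to deduction sets of `R(L)`. The logic of `P`
has the deduction formula `□p → q` with `□p = ¬ d(¬ p)`.

For strong non-additivity, let `f` be a term operation of an additive `g` on the subsets of `n`. If
membership of some `i` in `g(x)` does not depend on `x`, then agreement on membership of `i` is a
congruence for `g`, hence for `f`. Otherwise `g(0) = 0` and `g(1) = 1` by monotonicity, so `{0, 1}`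
is closed under `g`, hence under `f`. Both fail for the two frames
(`BF.not_equivalentToAdditive`).
-/

namespace BF

/-! ### Terms and their values -/

namespace BTerm

variable {X Y : Type}

def sup (s t : BTerm X) : BTerm X := compl (inf (compl s) (compl t))

/-- The symmetric difference of two terms. -/
def xor (s t : BTerm X) : BTerm X := sup (inf s (compl t)) (inf t (compl s))

/-- A ground term, read as a term in an arbitrary set of variables. -/
def ground (k : BTerm Empty) : BTerm X := k.subst Empty.elim

section eval

variable {A : Type u} [BooleanAlgebra A] (f : A → A) (e : X → A)

@[simp] theorem eval_var (x : X) : (var x).eval f e = e x := rfl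
@[simp] theorem eval_bot : (bot : BTerm X).eval f e = ⊥ := rfl
@[simp] theorem eval_compl (s : BTerm X) : (compl s).eval f e = (s.eval f e)ᶜ := rfl
@[simp] theorem eval_inf (s t : BTerm X) : (inf s t).eval f e = s.eval f e ⊓ t.eval f e := rfl
@[simp] theorem eval_op (s : BTerm X) : (op s).eval f e = f (s.eval f e) := rfl
@[simp] theorem eval_top : (top : BTerm X).eval f e = ⊤ := by simp [top]

@[simp] theorem eval_sup (s t : BTerm X) : (sup s t).eval f e = s.eval f e ⊔ t.eval f e := by
  simp [sup]

@[simp] theorem eval_xor (s t : BTerm X) :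
    (xor s t).eval f e = symmDiff (s.eval f e) (t.eval f e) := by
  simp [xor, symmDiff, sdiff_eq]

@[simp] theorem eval_imp (s t : BTerm X) : (imp s t).eval f e = (s.eval f e)ᶜ ⊔ t.eval f e := by
  simp [imp]

@[simp] theorem eval_subst (σ : X → BTerm Y) (e : Y → A) (t : BTerm X) :
    (t.subst σ).eval f e = t.eval f (fun x => (σ x).eval f e) := by
  induction t with
  | var x => rfl
  | bot => rfl
  | compl s ih => simp [subst, ih]
  | inf s t ih₁ ih₂ => simp [subst, ih₁, ih₂]
  | op s ih => simp [subst, ih]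

theorem eval_iff_eq_top (s t : BTerm X) :
    (iff s t).eval f e = ⊤ ↔ s.eval f e = t.eval f e := by
  have imp_top (a b : A) : aᶜ ⊔ b = ⊤ ↔ a ≤ b := by
    rw [sup_comm, ← himp_eq, himp_eq_top_iff]
  rw [iff, eval_inf, inf_eq_top_iff, eval_imp, eval_imp, imp_top, imp_top, le_antisymm_iff]

/-- Homomorphisms commute with term operations. -/
theorem map_eval {B : Type v} [BooleanAlgebra B] (g : B → B) (h : A → B) (hbot : h ⊥ = ⊥)
    (hcompl : ∀ x, h xᶜ = (h x)ᶜ) (hinf : ∀ x y, h (x ⊓ y) = h x ⊓ h y)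
    (hop : ∀ x, h (f x) = g (h x)) (t : BTerm X) :
    h (t.eval f e) = t.eval g (fun x => h (e x)) := by
  induction t with
  | var x => rfl
  | bot => exact hbot
  | compl s ih => simp [hcompl, ih]
  | inf s t ih₁ ih₂ => simp [hinf, ih₁, ih₂]
  | op s ih => simp [hop, ih]

end eval

end BTerm

/-- The value of a ground term in a Boolean frame. -/
def BFrame.value (A : BFrame.{u}) (k : BTerm Empty) : A.carrier := k.eval A.op Empty.elim

theorem BFrame.eval_ground (A : BFrame.{u}) {X : Type} (e : X → A.carrier) (k : BTerm Empty) :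
    k.ground.eval A.op e = A.value k := by
  rw [BTerm.ground, BTerm.eval_subst, BFrame.value]
  congr 1
  exact funext fun x => x.elim

@[simp] theorem BFrame.value_compl (A : BFrame.{u}) (k : BTerm Empty) :
    A.value k.compl = (A.value k)ᶜ := rfl

/-- Subalgebras contain the values of ground terms. -/
theorem SubFrame.value_mem {A : BFrame.{u}} (B : SubFrame A) (k : BTerm Empty) :
    A.value k ∈ B.toSubalgebra := by
  unfold BFrame.value
  induction k with
  | var x => exact x.elim
  | bot => exact B.toSubalgebra.bot_mem
  | compl s ih => exact B.toSubalgebra.compl_mem ih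
  | inf s t ih₁ ih₂ => exact B.toSubalgebra.inf_mem ih₁ ih₂
  | op s ih => exact B.op_mem _ ih

namespace Congruence

variable {A : BFrame.{u}} (θ : Congruence A)

theorem refl (a : A.carrier) : θ.rel a a := θ.equivalence.refl a

theorem symm {a b : A.carrier} (h : θ.rel a b) : θ.rel b a := θ.equivalence.symm h

theorem trans {a b c : A.carrier} (h : θ.rel a b) (h' : θ.rel b c) : θ.rel a c :=
  θ.equivalence.trans h h'

theorem eval {X : Type} {e e' : X → A.carrier} (h : ∀ x, θ.rel (e x) (e' x)) (t : BTerm X) :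
    θ.rel (t.eval A.op e) (t.eval A.op e') := by
  induction t with
  | var x => exact h x
  | bot => exact θ.refl _
  | compl s ih => exact θ.compl ih
  | inf s t ih₁ ih₂ => exact θ.inf ih₁ ih₂
  | op s ih => exact θ.op ih

theorem sup {a b c d : A.carrier} (h : θ.rel a b) (h' : θ.rel c d) : θ.rel (a ⊔ c) (b ⊔ d) := by
  simpa [compl_inf] using θ.compl (θ.inf (θ.compl h) (θ.compl h'))

theorem symmDiff {a b c d : A.carrier} (h : θ.rel a b) (h' : θ.rel c d) :
    θ.rel (symmDiff a c) (symmDiff b d) := by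
  simp only [_root_.symmDiff, sdiff_eq]
  exact θ.sup (θ.inf h (θ.compl h')) (θ.inf h' (θ.compl h))

theorem symmDiff_bot_iff {a b : A.carrier} : θ.rel (_root_.symmDiff a b) ⊥ ↔ θ.rel a b := by
  constructor
  · intro h
    have := θ.symmDiff h (θ.refl b)
    rwa [symmDiff_symmDiff_cancel_right, bot_symmDiff] at this
  · intro h
    simpa using θ.symmDiff h (θ.refl b)

/-- Two elements are congruent as soon as they are congruent below `c` and below `cᶜ`. -/
theorem of_inf_of_inf_compl {a b : A.carrier} (c : A.carrier) (h : θ.rel (a ⊓ c) (b ⊓ c))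
    (h' : θ.rel (a ⊓ cᶜ) (b ⊓ cᶜ)) : θ.rel a b := by
  have := θ.sup h h'
  rwa [← inf_sup_left, ← inf_sup_left, sup_compl_eq_top, inf_top_eq, inf_top_eq] at this

end Congruence

/-! ### Relativization to an element -/

/-- The Boolean algebra of the elements below `c`, with complements relative to `c`. -/
instance iicBooleanAlgebra {A : Type u} [BooleanAlgebra A] (c : A) :
    BooleanAlgebra (Set.Iic c) where
  le_sup_inf x y z := Subtype.coe_le_coe.1 (le_sup_inf (x := x.1) (y := y.1) (z := z.1))
  compl x := ⟨x.1ᶜ ⊓ c, inf_le_right⟩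
  top := ⟨c, le_refl c⟩
  bot := ⟨⊥, bot_le⟩
  inf_compl_le_bot x := by
    refine Subtype.coe_le_coe.1 ?_
    change x.1 ⊓ (x.1ᶜ ⊓ c) ≤ ⊥
    rw [← inf_assoc, inf_compl_eq_bot, bot_inf_eq]
  top_le_sup_compl x := by
    refine Subtype.coe_le_coe.1 ?_
    change c ≤ x.1 ⊔ (x.1ᶜ ⊓ c)
    rw [sup_inf_left, sup_compl_eq_top, top_inf_eq]
    exact le_sup_right
  le_top x := x.2
  bot_le x := Subtype.coe_le_coe.1 (bot_le (a := x.1))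

namespace BFrame

variable (A : BFrame.{u}) (c : A.carrier)

/-- The frame of the elements below `c`, with `x ↦ f(x) ⊓ c`. -/
def relativize : BFrame.{u} where
  carrier := Set.Iic c
  op x := ⟨A.op x.1 ⊓ c, inf_le_right⟩

/-- The map `x ↦ x ⊓ c` onto the relativization. -/
def proj (x : A.carrier) : (A.relativize c).carrier := ⟨x ⊓ c, inf_le_right⟩

/-- The condition on `c` under which `x ↦ x ⊓ c` is a homomorphism onto the relativization. -/
def IsFactor : Prop := ∀ x, A.op (x ⊓ c) ⊓ c = A.op x ⊓ c

variable {A c}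

theorem coe_compl (x : (A.relativize c).carrier) : (xᶜ).1 = x.1ᶜ ⊓ c := rfl

theorem proj_coe (x : (A.relativize c).carrier) : A.proj c x.1 = x :=
  Subtype.ext (inf_eq_left.2 x.2)

theorem proj_bot : A.proj c ⊥ = ⊥ := Subtype.ext (bot_inf_eq c)

theorem proj_inf (x y : A.carrier) : A.proj c (x ⊓ y) = A.proj c x ⊓ A.proj c y :=
  Subtype.ext (inf_inf_distrib_right x y c)

theorem proj_compl (x : A.carrier) : A.proj c xᶜ = (A.proj c x)ᶜ := by
  refine Subtype.ext ?_
  rw [coe_compl]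
  change xᶜ ⊓ c = (x ⊓ c)ᶜ ⊓ c
  rw [compl_inf, inf_sup_right, compl_inf_self, sup_bot_eq]

theorem IsFactor.proj_op (h : A.IsFactor c) (x : A.carrier) :
    A.proj c (A.op x) = (A.relativize c).op (A.proj c x) :=
  Subtype.ext (h x).symm

theorem IsFactor.proj_eval (h : A.IsFactor c) {X : Type} (e : X → A.carrier) (t : BTerm X) :
    A.proj c (t.eval A.op e) = t.eval (A.relativize c).op (fun x => A.proj c (e x)) :=
  BTerm.map_eval A.op e (A.relativize c).op (A.proj c) proj_bot proj_compl proj_inf h.proj_op t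

theorem proj_eq_iff {x y : A.carrier} : A.proj c x = A.proj c y ↔ x ⊓ c = y ⊓ c :=
  Subtype.ext_iff

theorem IsFactor.satisfies_iff (h : A.IsFactor c) (p : Equation) :
    (A.relativize c).Satisfies p ↔
      ∀ e : ℕ → A.carrier, p.1.eval A.op e ⊓ c = p.2.eval A.op e ⊓ c := by
  constructor
  · intro H e
    rw [← proj_eq_iff, h.proj_eval, h.proj_eval]
    exact H _
  · intro H e
    have := proj_eq_iff.2 (H fun x => (e x).1)
    simpa only [h.proj_eval, proj_coe] using this

/-- An equation holds in `A` if it holds in the two factors of a direct decomposition of `A`. -/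
theorem satisfies_of_relativize (h : A.IsFactor c) (h' : A.IsFactor cᶜ) (p : Equation)
    (H : (A.relativize c).Satisfies p) (H' : (A.relativize cᶜ).Satisfies p) : A.Satisfies p := by
  intro e
  have h₁ := (h.satisfies_iff p).1 H e
  have h₂ := (h'.satisfies_iff p).1 H' e
  rw [← inf_top_eq (p.1.eval A.op e), ← inf_top_eq (p.2.eval A.op e), ← sup_compl_eq_top (x := c),
    inf_sup_left, inf_sup_left, h₁, h₂]

end BFrame

namespace Congruence

variable {A : BFrame.{u}} {c : A.carrier}

/-- The congruence of `A` induced by a congruence of a factor. -/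
def comap (h : A.IsFactor c) (θ : Congruence (A.relativize c)) : Congruence A where
  rel x y := θ.rel (A.proj c x) (A.proj c y)
  equivalence := ⟨fun _ => θ.refl _, θ.symm, θ.trans⟩
  inf h₁ h₂ := by
    rw [BFrame.proj_inf, BFrame.proj_inf]
    exact θ.inf h₁ h₂
  compl h₁ := by
    rw [BFrame.proj_compl, BFrame.proj_compl]
    exact θ.compl h₁
  op h₁ := by
    rw [h.proj_op, h.proj_op]
    exact θ.op h₁

/-- The congruence of a relativization induced by a congruence of `A`. -/
def relativize (θ : Congruence A) (c : A.carrier) : Congruence (A.relativize c) where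
  rel x y := θ.rel x.1 y.1
  equivalence := ⟨fun _ => θ.refl _, θ.symm, θ.trans⟩
  inf h₁ h₂ := θ.inf h₁ h₂
  compl h₁ := θ.inf (θ.compl h₁) (θ.refl c)
  op h₁ := θ.inf (θ.op h₁) (θ.refl c)

/-- The intersection of two congruences. -/
def meet (θ ψ : Congruence A) : Congruence A where
  rel x y := θ.rel x y ∧ ψ.rel x y
  equivalence := ⟨fun _ => ⟨θ.refl _, ψ.refl _⟩, fun h => ⟨θ.symm h.1, ψ.symm h.2⟩,
    fun h h' => ⟨θ.trans h.1 h'.1, ψ.trans h.2 h'.2⟩⟩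
  inf h h' := ⟨θ.inf h.1 h'.1, ψ.inf h.2 h'.2⟩
  compl h := ⟨θ.compl h.1, ψ.compl h.2⟩
  op h := ⟨θ.op h.1, ψ.op h.2⟩

/-- The identity congruence. -/
def diag (A : BFrame.{u}) : Congruence A where
  rel x y := x = y
  equivalence := ⟨fun _ => rfl, Eq.symm, Eq.trans⟩
  inf h h' := by rw [h, h']
  compl h := by rw [h]
  op h := by rw [h]

/-- In a subdirectly irreducible algebra, of two congruences with trivial intersection one is
trivial. -/
theorem eq_or_eq_of_meet (hA : A.SubdirectlyIrreducible) (θ ψ : Congruence A)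
    (h : ∀ x y, θ.rel x y → ψ.rel x y → x = y) :
    (∀ x y, θ.rel x y → x = y) ∨ (∀ x y, ψ.rel x y → x = y) := by
  obtain ⟨μ, ⟨a, b, hab, hne⟩, hμ⟩ := hA
  by_contra H
  push Not at H
  obtain ⟨⟨x, y, hxy, hxy'⟩, ⟨z, w, hzw, hzw'⟩⟩ := H
  exact hne (h a b (hμ θ ⟨x, y, hxy, hxy'⟩ a b hab) (hμ ψ ⟨z, w, hzw, hzw'⟩ a b hab))

end Congruence

/-! ### Joins of varieties separated by a ground term -/

namespace Variety

/-- The ground term `k` has the value `1` in all members of `V` and `0` in all members of `W`. -/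
structure Separated (k : BTerm Empty) (V W : Variety.{u}) : Prop where
  left : ∀ A ∈ V.members, A.value k = ⊤
  right : ∀ A ∈ W.members, A.value k = ⊥

theorem Separated.symm {k : BTerm Empty} {V W : Variety.{u}} (h : Separated k V W) :
    Separated k.compl W V :=
  ⟨fun A hA => by simp [h.right A hA], fun A hA => by simp [h.left A hA]⟩

theorem mem_sup_iff {V W : Variety.{u}} {A : BFrame.{u}} :
    A ∈ (V ⊔ W).members ↔ ∀ p : Equation, (∀ B ∈ V.members, B.Satisfies p) →
      (∀ B ∈ W.members, B.Satisfies p) → A.Satisfies p :=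
  ⟨fun h p h₁ h₂ => h p fun B hB => hB.elim (h₁ B) (h₂ B),
    fun h p hp => h p (fun B hB => hp B (Or.inl hB)) fun B hB => hp B (Or.inr hB)⟩

theorem mem_of_forall_satisfies {V : Variety.{u}} {A : BFrame.{u}}
    (h : ∀ p : Equation, (∀ B ∈ V.members, B.Satisfies p) → A.Satisfies p) : A ∈ V.members := by
  obtain ⟨E, hE⟩ := V.equational
  rw [hE]
  exact fun p hp => h p fun B hB => by rw [hE] at hB; exact hB p hp

variable {k : BTerm Empty} {V W : Variety.{u}} {A : BFrame.{u}}

/-- The equation `s ⊓ k = t ⊓ k` holds in the join if `s = t` holds in `V`. -/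
theorem Separated.eval_inf_eq (h : Separated k V W) (hA : A ∈ (V ⊔ W).members) {s t : BTerm ℕ}
    (hst : ∀ B ∈ V.members, B.Satisfies (s, t)) (e : ℕ → A.carrier) :
    s.eval A.op e ⊓ A.value k = t.eval A.op e ⊓ A.value k := by
  have := mem_sup_iff.1 hA (s.inf k.ground, t.inf k.ground) (fun B hB e => ?_) (fun B hB e => ?_) e
  · simpa [BFrame.eval_ground] using this
  · simp [BFrame.eval_ground, h.left B hB]
    exact hst B hB e
  · simp [BFrame.eval_ground, h.right B hB]

theorem Separated.isFactor (h : Separated k V W) (hA : A ∈ (V ⊔ W).members) :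
    A.IsFactor (A.value k) := by
  intro x
  have := h.eval_inf_eq hA (s := .op (.inf (.var 0) k.ground)) (t := .op (.var 0))
    (fun B hB e => by simp [BFrame.eval_ground, h.left B hB]) fun _ => x
  simpa [BFrame.eval_ground] using this

theorem Separated.relativize_mem (h : Separated k V W) (hA : A ∈ (V ⊔ W).members) :
    A.relativize (A.value k) ∈ V.members :=
  mem_of_forall_satisfies fun p hp =>
    ((h.isFactor hA).satisfies_iff p).2 fun e => h.eval_inf_eq hA hp e

theorem Separated.isFactor_compl (h : Separated k V W) (hA : A ∈ (V ⊔ W).members) :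
    A.IsFactor (A.value k)ᶜ := by
  rw [sup_comm] at hA
  exact h.symm.isFactor hA

theorem Separated.relativize_compl_mem (h : Separated k V W) (hA : A ∈ (V ⊔ W).members) :
    A.relativize (A.value k)ᶜ ∈ W.members := by
  rw [sup_comm] at hA
  exact h.symm.relativize_mem hA

theorem mem_sup_of_relativize {c : A.carrier} (h : A.IsFactor c) (h' : A.IsFactor cᶜ)
    (hV : A.relativize c ∈ V.members) (hW : A.relativize cᶜ ∈ W.members) :
    A ∈ (V ⊔ W).members :=
  mem_sup_iff.2 fun p hp hp' =>
    BFrame.satisfies_of_relativize h h' p (hp _ hV) (hp' _ hW)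

theorem Separated.mem_left (h : Separated k V W) (hA : A ∈ (V ⊔ W).members)
    (hk : A.value k = ⊤) : A ∈ V.members :=
  mem_of_forall_satisfies fun p hp e => by simpa [hk] using h.eval_inf_eq hA hp e

theorem Separated.mem_right (h : Separated k V W) (hA : A ∈ (V ⊔ W).members)
    (hk : A.value k = ⊥) : A ∈ W.members := by
  rw [sup_comm] at hA
  exact h.symm.mem_left hA (by simp [hk])

/-- Joining with a separated variety preserves meets. -/
theorem Separated.inf_sup {V' : Variety.{u}} (h : Separated k V W) (h' : Separated k V' W) :
    (V ⊓ V') ⊔ W = (V ⊔ W) ⊓ (V' ⊔ W) := by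
  refine le_antisymm (le_inf (sup_le_sup_right inf_le_left W) (sup_le_sup_right inf_le_right W))
    fun A hA => ?_
  exact mem_sup_of_relativize (h.isFactor hA.1) (h.isFactor_compl hA.1)
    ⟨h.relativize_mem hA.1, h'.relativize_mem hA.2⟩ (h.relativize_compl_mem hA.1)

/-- Joining with a separated variety reflects the order. -/
theorem Separated.le_of_sup_le {V' : Variety.{u}} (h : Separated k V W) (h' : Separated k V' W)
    (hle : V ⊔ W ≤ V' ⊔ W) : V ≤ V' :=
  fun A hA => h'.mem_left (hle (le_sup_left (a := V) hA)) (h.left A hA)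

/-! ### Properties inherited by separated joins -/

theorem Separated.cep (h : Separated k V W) (hV : V.CEP) (hW : W.CEP) : (V ⊔ W).CEP := by
  intro A hA B θ
  -- each factor yields a congruence that extends `θ` there
  have key (l : BTerm Empty) (hl : (A.relativize (A.value l)).CEP) (hf : A.IsFactor (A.value l)) :
      ∃ ψ : Congruence A, ∀ x y : B.toSubalgebra,
        θ.rel (x ⊓ ⟨_, B.value_mem l⟩) (y ⊓ ⟨_, B.value_mem l⟩) ↔ ψ.rel x.1 y.1 := by
    let B' : SubFrame (A.relativize (A.value l)) :=
      { toSubalgebra :=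
          { carrier := {x | x.1 ∈ B.toSubalgebra}
            supClosed' := fun x hx y hy => B.toSubalgebra.sup_mem hx hy
            infClosed' := fun x hx y hy => B.toSubalgebra.inf_mem hx hy
            compl_mem' := fun {x} hx =>
              B.toSubalgebra.inf_mem (B.toSubalgebra.compl_mem hx) (B.value_mem l)
            bot_mem' := B.toSubalgebra.bot_mem }
        op_mem := fun x hx => B.toSubalgebra.inf_mem (B.op_mem _ hx) (B.value_mem l) }
    let θ' : Congruence B'.frame :=
      { rel := fun x y => θ.rel ⟨x.1.1, x.2⟩ ⟨y.1.1, y.2⟩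
        equivalence := ⟨fun _ => θ.refl _, θ.symm, θ.trans⟩
        inf := fun h₁ h₂ => θ.inf h₁ h₂
        compl := fun h₁ => θ.inf (θ.compl h₁) (θ.refl ⟨_, B.value_mem l⟩)
        op := fun h₁ => θ.inf (θ.op h₁) (θ.refl ⟨_, B.value_mem l⟩) }
    obtain ⟨ψ, hψ⟩ := hl B' θ'
    refine ⟨ψ.comap hf, fun x y => ?_⟩
    exact hψ ⟨A.proj _ x.1, B.toSubalgebra.inf_mem x.2 (B.value_mem l)⟩
      ⟨A.proj _ y.1, B.toSubalgebra.inf_mem y.2 (B.value_mem l)⟩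
  obtain ⟨ψ₁, hψ₁⟩ := key k (hV _ (h.relativize_mem hA)) (h.isFactor hA)
  obtain ⟨ψ₂, hψ₂⟩ := key k.compl (hW _ (h.relativize_compl_mem hA)) (h.isFactor_compl hA)
  refine ⟨ψ₁.meet ψ₂, fun x y => ⟨fun hxy => ?_, fun hxy => ?_⟩⟩
  · exact ⟨(hψ₁ x y).1 (θ.inf hxy (θ.refl _)), (hψ₂ x y).1 (θ.inf hxy (θ.refl _))⟩
  · exact θ.of_inf_of_inf_compl ⟨_, B.value_mem k⟩ ((hψ₁ x y).2 hxy.1) ((hψ₂ x y).2 hxy.2)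

/-- Principal congruences are computed in the two factors of a direct decomposition. -/
theorem principalCongruence_iff {c : A.carrier} (h : A.IsFactor c) (h' : A.IsFactor cᶜ)
    (x y z w : A.carrier) :
    PrincipalCongruence A x y z w ↔
      PrincipalCongruence (A.relativize c) (A.proj c x) (A.proj c y) (A.proj c z) (A.proj c w) ∧
        PrincipalCongruence (A.relativize cᶜ) (A.proj cᶜ x) (A.proj cᶜ y) (A.proj cᶜ z)
          (A.proj cᶜ w) := by
  constructor
  · intro H
    exact ⟨fun θ hθ => H (θ.comap h) hθ, fun θ hθ => H (θ.comap h') hθ⟩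
  · rintro ⟨H, H'⟩ θ hθ
    exact θ.of_inf_of_inf_compl c (H (θ.relativize c) (θ.inf hθ (θ.refl c)))
      (H' (θ.relativize cᶜ) (θ.inf hθ (θ.refl cᶜ)))

theorem Separated.edpc (h : Separated k V W) (hV : V.EDPC) (hW : W.EDPC) : (V ⊔ W).EDPC := by
  obtain ⟨n, p, q, hV⟩ := hV
  obtain ⟨m, p', q', hW⟩ := hW
  refine ⟨n + m, Fin.append (fun i => (p i).inf k.ground) (fun i => (p' i).inf k.compl.ground),
    Fin.append (fun i => (q i).inf k.ground) (fun i => (q' i).inf k.compl.ground),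
    fun A hA x y z w => ?_⟩
  have proj_vec (c : A.carrier) : ![A.proj c x, A.proj c y, A.proj c z, A.proj c w] =
      fun i => A.proj c (![x, y, z, w] i) := by
    funext i
    fin_cases i <;> rfl
  rw [principalCongruence_iff (h.isFactor hA) (h.isFactor_compl hA),
    hV _ (h.relativize_mem hA), hW _ (h.relativize_compl_mem hA), proj_vec, proj_vec]
  simp only [← (h.isFactor hA).proj_eval, ← (h.isFactor_compl hA).proj_eval, BFrame.proj_eq_iff]
  constructor
  · rintro ⟨h₁, h₂⟩ i
    refine Fin.addCases (fun i => ?_) (fun i => ?_) i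
    · simpa [BFrame.eval_ground] using h₁ i
    · simpa [BFrame.eval_ground] using h₂ i
  · intro H
    exact ⟨fun i => by simpa [BFrame.eval_ground] using H (Fin.castAdd m i),
      fun i => by simpa [BFrame.eval_ground] using H (Fin.natAdd n i)⟩

/-- A subdirectly irreducible member of a separated join belongs to one of the two varieties. -/
theorem Separated.value_eq_top_or_bot (h : Separated k V W) (hA : A ∈ (V ⊔ W).members)
    (hsi : A.SubdirectlyIrreducible) : A.value k = ⊤ ∨ A.value k = ⊥ := by
  have hl := h.isFactor hA
  have hr := h.isFactor_compl hA
  refine (Congruence.eq_or_eq_of_meet hsi ((Congruence.diag _).comap hl)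
    ((Congruence.diag _).comap hr) fun x y h₁ h₂ => ?_).imp (fun H => ?_) (fun H => ?_)
  · exact (Congruence.diag A).of_inf_of_inf_compl (A.value k) (BFrame.proj_eq_iff.1 h₁)
      (BFrame.proj_eq_iff.1 h₂)
  · exact H _ _ (BFrame.proj_eq_iff.2 (by simp))
  · exact H _ _ (BFrame.proj_eq_iff.2 (by simp))

theorem Separated.isDiscriminator (h : Separated k V W) (hV : V.IsDiscriminator)
    (hW : W.IsDiscriminator) : (V ⊔ W).IsDiscriminator := by
  obtain ⟨s, hs⟩ := hV
  obtain ⟨t, ht⟩ := hW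
  refine ⟨(s.inf k.ground).sup (t.inf k.compl.ground), fun A hA hsi a b c => ?_⟩
  rcases h.value_eq_top_or_bot hA hsi with hk | hk
  · simpa [BFrame.eval_ground, hk] using hs A (h.mem_left hA hk) hsi a b c
  · simpa [BFrame.eval_ground, hk] using ht A (h.mem_right hA hk) hsi a b c

end Variety

/-! ### Varieties generated by a frame with a unary discriminator -/

/-- The unary operation defined by a term in one variable. -/
def BFrame.unary (A : BFrame.{u}) (d : BTerm Unit) (x : A.carrier) : A.carrier :=
  d.eval A.op fun _ => x

/-- The term in the variables `X` obtained by applying a unary term to another term. -/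
def BTerm.app {X : Type} (d : BTerm Unit) (t : BTerm X) : BTerm X := d.subst fun _ => t

@[simp] theorem BFrame.eval_app (A : BFrame.{u}) {X : Type} (e : X → A.carrier) (d : BTerm Unit)
    (t : BTerm X) : (d.app t).eval A.op e = A.unary d (t.eval A.op e) := by
  simp [BTerm.app, BFrame.unary]

/-- The term `d` is a unary discriminator on `P`: it maps `0` to `0` and everything else to `1`. -/
structure IsUnaryDiscriminator (P : BFrame.{u}) (d : BTerm Unit) : Prop where
  bot : P.unary d ⊥ = ⊥
  eq_top : ∀ x, x ≠ ⊥ → P.unary d x = ⊤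

/-- The equational properties of a unary discriminator on which the description of congruences
depends. -/
structure IsClosureTerm (A : BFrame.{u}) (d : BTerm Unit) : Prop where
  bot : A.unary d ⊥ = ⊥
  le : ∀ x, x ≤ A.unary d x
  sup : ∀ x y, A.unary d (x ⊔ y) = A.unary d x ⊔ A.unary d y
  idem : ∀ x, A.unary d (A.unary d x) = A.unary d x
  compl : ∀ x, A.unary d (A.unary d x)ᶜ = (A.unary d x)ᶜ
  op : ∀ x y, symmDiff (A.op x) (A.op y) ≤ A.unary d (symmDiff x y)

theorem Variety.mem_generatedBy_iff {P : BFrame.{v}} {A : BFrame.{u}} :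
    A ∈ (Variety.generatedBy.{u} P).members ↔
      ∀ p : Equation, P.Satisfies p → A.Satisfies p :=
  ⟨fun h p hp => h p fun B hB => by rw [Set.mem_singleton_iff.1 hB]; exact hp,
    fun h p hp => h p (hp P rfl)⟩

theorem IsUnaryDiscriminator.isClosureTerm {P : BFrame.{u}} {d : BTerm Unit}
    (h : IsUnaryDiscriminator P d) : IsClosureTerm P d := by
  have h01 (x : P.carrier) : P.unary d x = ⊥ ∨ P.unary d x = ⊤ := by
    by_cases hx : x = ⊥
    · exact Or.inl (hx ▸ h.bot)
    · exact Or.inr (h.eq_top x hx)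
  have htop : P.unary d ⊤ = ⊤ := by
    by_cases ht : (⊤ : P.carrier) = ⊥
    · rw [ht, h.bot]
    · exact h.eq_top _ ht
  have hle (x : P.carrier) : x ≤ P.unary d x := by
    by_cases hx : x = ⊥
    · simp [hx]
    · simp [h.eq_top x hx]
  refine ⟨h.bot, hle, fun x y => ?_, fun x => ?_, fun x => ?_, fun x y => ?_⟩
  · by_cases hx : x = ⊥
    · simp [hx, h.bot]
    · rw [h.eq_top x hx, h.eq_top (x ⊔ y) fun hxy => hx (sup_eq_bot_iff.1 hxy).1, top_sup_eq]
  · rcases h01 x with hx | hx <;> simp [hx, h.bot, htop]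
  · rcases h01 x with hx | hx <;> simp [hx, h.bot, htop]
  · by_cases hxy : x = y
    · simp [hxy]
    · rw [h.eq_top (symmDiff x y) fun H => hxy (symmDiff_eq_bot.1 H)]
      exact le_top

theorem IsClosureTerm.of_mem_generatedBy {P : BFrame.{v}} {d : BTerm Unit}
    (h : IsClosureTerm P d) {A : BFrame.{u}} (hA : A ∈ (Variety.generatedBy.{u} P).members) :
    IsClosureTerm A d := by
  have key (s t : BTerm ℕ) (hst : P.Satisfies (s, t)) (x y : A.carrier) :
      s.eval A.op (fun n => if n = 0 then x else y) =
        t.eval A.op (fun n => if n = 0 then x else y) :=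
    Variety.mem_generatedBy_iff.1 hA (s, t) hst _
  refine ⟨?_, fun x => ?_, fun x y => ?_, fun x => ?_, fun x => ?_, fun x y => ?_⟩
  · simpa using key (d.app .bot) .bot (fun e => by simp [h.bot]) ⊥ ⊥
  · simpa using key (.inf (.var 0) (d.app (.var 0))) (.var 0) (fun e => by simp [h.le]) x x
  · simpa using key (d.app (.sup (.var 0) (.var 1)))
      (.sup (d.app (.var 0)) (d.app (.var 1))) (fun e => by simp [h.sup]) x y
  · simpa using key (d.app (d.app (.var 0))) (d.app (.var 0)) (fun e => by simp [h.idem]) x x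
  · simpa using key (d.app (d.app (.var 0)).compl) (d.app (.var 0)).compl
      (fun e => by simp [h.compl]) x x
  · simpa using key (.inf (.xor (.op (.var 0)) (.op (.var 1))) (d.app (.xor (.var 0) (.var 1))))
      (.xor (.op (.var 0)) (.op (.var 1))) (fun e => by simp [h.op]) x y

namespace IsClosureTerm

variable {A : BFrame.{u}} {d : BTerm Unit}

theorem mono (h : IsClosureTerm A d) {x y : A.carrier} (hxy : x ≤ y) :
    A.unary d x ≤ A.unary d y := by
  rw [← sup_eq_right.2 hxy, h.sup]
  exact le_sup_left

/-- The ideals closed under `d` induce congruences. -/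
def congruence (h : IsClosureTerm A d) (I : Set A.carrier) (hbot : ⊥ ∈ I)
    (hsup : ∀ x ∈ I, ∀ y ∈ I, x ⊔ y ∈ I) (hlow : ∀ x ∈ I, ∀ y, y ≤ x → y ∈ I)
    (hd : ∀ x ∈ I, A.unary d x ∈ I) : Congruence A where
  rel x y := symmDiff x y ∈ I
  equivalence :=
    ⟨fun x => by rwa [symmDiff_self], fun {x y} hxy => by rwa [symmDiff_comm],
      fun {x y z} hxy hyz => hlow _ (hsup _ hxy _ hyz) _ (symmDiff_triangle x y z)⟩
  inf {a b c e} hab hce := by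
    refine hlow _ (hsup _ hab _ hce) _ ?_
    refine (symmDiff_triangle _ (b ⊓ c) _).trans (sup_le_sup ?_ ?_)
    · rw [← inf_symmDiff_distrib_right]
      exact inf_le_left
    · rw [← inf_symmDiff_distrib_left]
      exact inf_le_right
  compl {a b} hab := by rwa [compl_symmDiff_compl]
  op {a b} hab := hlow _ (hd _ hab) _ (h.op a b)

/-- The congruence of all pairs whose symmetric difference is below the closed element `c`. -/
def congruenceLE (h : IsClosureTerm A d) (c : A.carrier) (hc : A.unary d c = c) :
    Congruence A :=
  h.congruence (Set.Iic c) bot_le (fun _ hx _ hy => sup_le hx hy)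
    (fun _ hx _ hy => le_trans hy hx) fun _ hx => (h.mono hx).trans hc.le

theorem rel_unary_bot (h : IsClosureTerm A d) (θ : Congruence A) {x : A.carrier}
    (hx : θ.rel x ⊥) : θ.rel (A.unary d x) ⊥ := by
  rw [← h.bot]
  exact θ.eval (fun _ => hx) d

theorem principalCongruence_iff (h : IsClosureTerm A d) (x y z w : A.carrier) :
    PrincipalCongruence A x y z w ↔ symmDiff z w ≤ A.unary d (symmDiff x y) := by
  constructor
  · intro H
    exact H (h.congruenceLE _ (h.idem _)) (h.le _)
  · intro H θ hθ
    have := θ.inf (θ.refl (symmDiff z w)) (h.rel_unary_bot θ (θ.symmDiff_bot_iff.2 hθ))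
    rw [inf_eq_left.2 H, inf_bot_eq] at this
    exact θ.symmDiff_bot_iff.1 this

theorem cep (h : IsClosureTerm A d) : A.CEP := by
  intro B θ
  have hcoe (b : B.frame.carrier) : (B.frame.unary d b).1 = A.unary d b.1 :=
    BTerm.map_eval B.frame.op (fun _ => b) A.op Subtype.val rfl (fun _ => rfl)
      (fun _ _ => rfl) (fun _ => rfl) d
  -- the ideal of `A` generated by the class of `0` in the subalgebra
  let I : Set A.carrier := {x | ∃ b : B.frame.carrier, θ.rel b ⊥ ∧ x ≤ b.1}
  have hI (x y : B.frame.carrier) : θ.rel x y ↔ symmDiff x.1 y.1 ∈ I := by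
    constructor
    · intro hxy
      exact ⟨symmDiff x y, θ.symmDiff_bot_iff.2 hxy, le_of_eq rfl⟩
    · rintro ⟨b, hb, hle⟩
      have := θ.inf (θ.refl (symmDiff x y)) hb
      rw [inf_bot_eq, inf_eq_left.2 (show symmDiff x y ≤ b from hle)] at this
      exact θ.symmDiff_bot_iff.1 this
  refine ⟨h.congruence I ⟨⊥, θ.refl _, bot_le⟩ ?_ ?_ ?_, hI⟩
  · rintro x ⟨b, hb, hx⟩ y ⟨b', hb', hy⟩
    have := θ.sup hb hb'
    rw [sup_idem] at this
    exact ⟨b ⊔ b', this, sup_le_sup hx hy⟩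
  · rintro x ⟨b, hb, hx⟩ y hy
    exact ⟨b, hb, hy.trans hx⟩
  · rintro x ⟨b, hb, hx⟩
    have hbot : B.frame.unary d ⊥ = ⊥ := Subtype.ext ((hcoe ⊥).trans h.bot)
    refine ⟨B.frame.unary d b, ?_, (h.mono hx).trans (hcoe b).ge⟩
    rw [← hbot]
    exact θ.eval (fun _ => hb) d

theorem unary_eq_top (h : IsClosureTerm A d) (hA : A.SubdirectlyIrreducible) {x : A.carrier}
    (hx : x ≠ ⊥) : A.unary d x = ⊤ := by
  have htriv (y z : A.carrier) (h₁ : symmDiff y z ≤ A.unary d x)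
      (h₂ : symmDiff y z ≤ (A.unary d x)ᶜ) : y = z := by
    refine symmDiff_eq_bot.1 (le_bot_iff.1 ?_)
    rw [← inf_compl_eq_bot (a := A.unary d x)]
    exact le_inf h₁ h₂
  rcases Congruence.eq_or_eq_of_meet hA (h.congruenceLE _ (h.idem x))
    (h.congruenceLE _ (h.compl x)) htriv with H | H
  · refine absurd (H x ⊥ ?_) hx
    change symmDiff x ⊥ ≤ _
    rw [symmDiff_bot]
    exact h.le x
  · have := H (A.unary d x)ᶜ ⊥ ?_
    · rwa [compl_eq_bot] at this
    · change symmDiff _ ⊥ ≤ _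
      rw [symmDiff_bot]

end IsClosureTerm

namespace IsUnaryDiscriminator

variable {P : BFrame.{v}} {d : BTerm Unit}

theorem cep (h : IsUnaryDiscriminator P d) : (Variety.generatedBy.{u} P).CEP :=
  fun _ hA => (h.isClosureTerm.of_mem_generatedBy hA).cep

theorem edpc (h : IsUnaryDiscriminator P d) : (Variety.generatedBy.{u} P).EDPC := by
  refine ⟨1, fun _ => .inf (.xor (.var 2) (.var 3)) (d.app (.xor (.var 0) (.var 1))),
    fun _ => .xor (.var 2) (.var 3), fun A hA x y z w => ?_⟩
  rw [(h.isClosureTerm.of_mem_generatedBy hA).principalCongruence_iff]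
  simp

theorem isDiscriminator (h : IsUnaryDiscriminator P d) :
    (Variety.generatedBy.{u} P).IsDiscriminator := by
  refine ⟨.sup (.inf (.var 0) (d.app (.xor (.var 0) (.var 1))))
    (.inf (.var 2) (d.app (.xor (.var 0) (.var 1))).compl), fun A hA hsi x y z => ?_⟩
  have hd := h.isClosureTerm.of_mem_generatedBy hA
  constructor
  · intro hxy
    simp [hd.unary_eq_top hsi fun H => hxy (symmDiff_eq_bot.1 H)]
  · rintro rfl
    simp [hd.bot]

end IsUnaryDiscriminator

/-! ### Derivations in congruential logics -/

theorem BTerm.subst_ground {X Y : Type} (σ : X → BTerm Y) (k : BTerm Empty) :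
    (k.ground : BTerm X).subst σ = k.ground := by
  unfold BTerm.ground
  induction k with
  | var x => exact x.elim
  | bot => rfl
  | compl s ih => exact congrArg BTerm.compl ih
  | inf s t ih₁ ih₂ => exact congrArg₂ BTerm.inf ih₁ ih₂
  | op s ih => exact congrArg BTerm.op ih

theorem BTerm.subst_app {X Y : Type} (σ : X → BTerm Y) (d : BTerm Unit) (t : BTerm X) :
    (d.app t).subst σ = d.app (t.subst σ) := by
  unfold BTerm.app
  induction d with
  | var x => rfl
  | bot => rfl
  | compl s ih => exact congrArg BTerm.compl ih
  | inf s t ih₁ ih₂ => exact congrArg₂ BTerm.inf ih₁ ih₂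
  | op s ih => exact congrArg BTerm.op ih

namespace CongruentialLogic

theorem theorems_injective : Function.Injective CongruentialLogic.theorems := by
  rintro ⟨S, _, _, _, _⟩ ⟨S', _, _, _, _⟩ h
  cases h
  rfl

variable {L L₁ L₂ : CongruentialLogic} {Γ : Set Form} {φ ψ χ κ : Form}

theorem mem_of_tautology (h : IsTautology (φ.imp ψ)) (hφ : φ ∈ L.theorems) : ψ ∈ L.theorems :=
  L.modusPonens φ ψ hφ (L.tautology _ h)

namespace Derives

theorem mono (hL : L₁.theorems ⊆ L₂.theorems) (h : L₁.Derives Γ φ) : L₂.Derives Γ φ := by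
  induction h with
  | thm h => exact .thm (hL h)
  | hyp h => exact .hyp h
  | mp _ _ ih₁ ih₂ => exact .mp ih₁ ih₂
  | re _ ih => exact .re ih

theorem of_tautology (h : IsTautology (φ.imp ψ)) (hφ : L.Derives Γ φ) : L.Derives Γ ψ :=
  .mp hφ (.thm (L.tautology _ h))

theorem of_tautology₂ (h : IsTautology (φ.imp (ψ.imp χ))) (hφ : L.Derives Γ φ)
    (hψ : L.Derives Γ ψ) : L.Derives Γ χ :=
  .mp hψ (.of_tautology h hφ)

theorem weaken (h : L.Derives Γ ψ) : L.Derives (insert φ Γ) ψ := by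
  induction h with
  | thm h => exact .thm h
  | hyp h => exact .hyp (Or.inr h)
  | mp _ _ ih₁ ih₂ => exact .mp ih₁ ih₂
  | re _ ih => exact .re ih

end Derives

/-- Below `κ`, the modal operator depends only on the part of its argument below `κ`. -/
def Localizes (L : CongruentialLogic) (κ : Form) : Prop :=
  ∀ α : Form, κ.imp (α.op.iff (α.inf κ).op) ∈ L.theorems

/-- The congruence rule may be applied under an assumption `κ` that localizes. -/
theorem Derives.imp_re (hκ : L.Localizes κ) (h : L.Derives Γ (κ.imp (φ.iff ψ))) :
    L.Derives Γ (κ.imp (φ.op.iff ψ.op)) := by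
  have h₁ : L.Derives Γ ((φ.inf κ).iff (ψ.inf κ)) := by
    refine h.of_tautology fun w hb hc hi => ?_
    simp only [BTerm.imp, BTerm.iff, hc, hi]
    tauto
  have h₂ : L.Derives Γ (κ.imp (φ.op.iff (ψ.inf κ).op)) := by
    refine .of_tautology₂ (fun w hb hc hi => ?_) (.thm (hκ φ)) h₁.re
    simp only [BTerm.imp, BTerm.iff, hc, hi]
    tauto
  refine .of_tautology₂ (fun w hb hc hi => ?_) (.thm (hκ ψ)) h₂
  simp only [BTerm.imp, BTerm.iff, hc, hi]
  tauto

/-! ### Intersections of logics separated by a ground formula -/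

/-- The intersection of two congruential logics. -/
def inter (L₁ L₂ : CongruentialLogic) : CongruentialLogic where
  theorems := L₁.theorems ∩ L₂.theorems
  tautology φ h := ⟨L₁.tautology φ h, L₂.tautology φ h⟩
  modusPonens φ ψ h h' := ⟨L₁.modusPonens φ ψ h.1 h'.1, L₂.modusPonens φ ψ h.2 h'.2⟩
  congruence φ ψ h := ⟨L₁.congruence φ ψ h.1, L₂.congruence φ ψ h.2⟩
  substitution φ σ h := ⟨L₁.substitution φ σ h.1, L₂.substitution φ σ h.2⟩

theorem inter_comm (L₁ L₂ : CongruentialLogic) : L₁.inter L₂ = L₂.inter L₁ :=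
  theorems_injective (Set.inter_comm _ _)

/-- The ground formula `k` is a theorem of `L₁`, and its negation is a theorem of `L₂`. -/
structure Separated (k : BTerm Empty) (L₁ L₂ : CongruentialLogic) : Prop where
  left : k.ground ∈ L₁.theorems
  right : k.compl.ground ∈ L₂.theorems

variable {k : BTerm Empty}

theorem Separated.symm (h : Separated k L₁ L₂) : Separated k.compl L₂ L₁ :=
  ⟨h.right, mem_of_tautology (fun w hb hc hi => by
    simp only [BTerm.imp, BTerm.ground, BTerm.subst, hc, hi]; tauto) h.left⟩

theorem Separated.imp_mem_right (h : Separated k L₁ L₂) (φ : Form) :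
    k.ground.imp φ ∈ L₂.theorems :=
  mem_of_tautology (fun w hb hc hi => by
    simp only [BTerm.imp, BTerm.ground, BTerm.subst, hc, hi]; tauto) h.right

theorem Separated.imp_mem_inter_iff (h : Separated k L₁ L₂) :
    k.ground.imp φ ∈ (L₁.inter L₂).theorems ↔ φ ∈ L₁.theorems := by
  constructor
  · intro H
    exact L₁.modusPonens _ _ h.left H.1
  · intro H
    exact ⟨mem_of_tautology (fun w hb hc hi => by simp only [BTerm.imp, hc, hi]; tauto) H,
      h.imp_mem_right φ⟩

theorem Separated.localizes (h : Separated k L₁ L₂) : (L₁.inter L₂).Localizes k.ground := by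
  intro α
  refine h.imp_mem_inter_iff.2 (L₁.congruence _ _ (mem_of_tautology (fun w hb hc hi => ?_) h.left))
  simp only [BTerm.imp, BTerm.iff, hc, hi]
  tauto

/-- Derivability in `L₁` is derivability in the intersection under the assumption `k`. -/
theorem Separated.derives_imp_iff (h : Separated k L₁ L₂) :
    (L₁.inter L₂).Derives Γ (k.ground.imp ψ) ↔ L₁.Derives Γ ψ := by
  constructor
  · intro H
    exact .mp (.thm h.left) (H.mono Set.inter_subset_left)
  · intro H
    induction H with
    | thm H => exact .thm (h.imp_mem_inter_iff.2 H)
    | hyp H =>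
      refine .of_tautology (fun w hb hc hi => ?_) (.hyp H)
      simp only [BTerm.imp, hc, hi]
      tauto
    | mp _ _ ih₁ ih₂ =>
      refine .of_tautology₂ (fun w hb hc hi => ?_) ih₁ ih₂
      simp only [BTerm.imp, hc, hi]
      tauto
    | re _ ih => exact ih.imp_re h.localizes

theorem Separated.derives_compl_imp_iff (h : Separated k L₁ L₂) :
    (L₁.inter L₂).Derives Γ (k.compl.ground.imp ψ) ↔ L₂.Derives Γ ψ := by
  rw [inter_comm]
  exact h.symm.derives_imp_iff

theorem Separated.derives_inter_iff (h : Separated k L₁ L₂) :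
    (L₁.inter L₂).Derives Γ ψ ↔ L₁.Derives Γ ψ ∧ L₂.Derives Γ ψ := by
  constructor
  · intro H
    exact ⟨H.mono Set.inter_subset_left, H.mono Set.inter_subset_right⟩
  · rintro ⟨H₁, H₂⟩
    refine .of_tautology₂ (fun w hb hc hi => ?_) (h.derives_imp_iff.2 H₁)
      (h.derives_compl_imp_iff.2 H₂)
    simp only [BTerm.imp, BTerm.ground, BTerm.subst, hc, hi]
    tauto

open Classical in
/-- The deduction set for the intersection that is obtained from deduction sets of the two logics:
the formulas of `Δ₁` relative to `k` together with those of `Δ₂` relative to its negation. -/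
noncomputable def combine (k : BTerm Empty) (Δ₁ Δ₂ : Finset (BTerm (Fin 2))) :
    Finset (BTerm (Fin 2)) :=
  Δ₁.image k.ground.imp ∪ Δ₂.image k.compl.ground.imp

theorem Separated.derives_combine_iff (h : Separated k L₁ L₂) (Δ₁ Δ₂ : Finset (BTerm (Fin 2)))
    (φ ψ : Form) :
    (∀ δ ∈ combine k Δ₁ Δ₂, (L₁.inter L₂).Derives Γ (δ.subst ![φ, ψ])) ↔
      (∀ δ ∈ Δ₁, L₁.Derives Γ (δ.subst ![φ, ψ])) ∧
        ∀ δ ∈ Δ₂, L₂.Derives Γ (δ.subst ![φ, ψ]) := by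
  have subst_imp (l : BTerm Empty) (δ : BTerm (Fin 2)) :
      (l.ground.imp δ).subst ![φ, ψ] = l.ground.imp (δ.subst ![φ, ψ]) := by
    simp only [BTerm.imp, BTerm.subst, BTerm.subst_ground]
  simp only [combine, Finset.mem_union, Finset.mem_image, or_imp, forall_and,
    forall_exists_index, and_imp, forall_apply_eq_imp_iff₂, subst_imp, h.derives_imp_iff,
    h.derives_compl_imp_iff]

theorem Separated.ddt (h : Separated k L₁ L₂) (h₁ : L₁.DDT) (h₂ : L₂.DDT) :
    (L₁.inter L₂).DDT := by
  obtain ⟨Δ₁, h₁⟩ := h₁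
  obtain ⟨Δ₂, h₂⟩ := h₂
  refine ⟨combine k Δ₁ Δ₂, fun Γ φ ψ => ?_⟩
  rw [h.derives_combine_iff, h.derives_inter_iff, h₁, h₂]

theorem Separated.lddt (h : Separated k L₁ L₂) (h₁ : L₁.LDDT) (h₂ : L₂.LDDT) :
    (L₁.inter L₂).LDDT := by
  obtain ⟨F₁, h₁⟩ := h₁
  obtain ⟨F₂, h₂⟩ := h₂
  refine ⟨{Δ | ∃ Δ₁ ∈ F₁, ∃ Δ₂ ∈ F₂, Δ = combine k Δ₁ Δ₂}, fun Γ φ ψ => ?_⟩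
  rw [h.derives_inter_iff, h₁, h₂]
  constructor
  · rintro ⟨⟨Δ₁, hΔ₁, H₁⟩, Δ₂, hΔ₂, H₂⟩
    exact ⟨_, ⟨Δ₁, hΔ₁, Δ₂, hΔ₂, rfl⟩, (h.derives_combine_iff Δ₁ Δ₂ φ ψ).2 ⟨H₁, H₂⟩⟩
  · rintro ⟨_, ⟨Δ₁, hΔ₁, Δ₂, hΔ₂, rfl⟩, H⟩
    have := (h.derives_combine_iff Δ₁ Δ₂ φ ψ).1 H
    exact ⟨⟨Δ₁, hΔ₁, this.1⟩, Δ₂, hΔ₂, this.2⟩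

theorem DDT.lddt (h : L.DDT) : L.LDDT := by
  obtain ⟨Δ, hΔ⟩ := h
  exact ⟨{Δ}, fun Γ φ ψ => by simp [hΔ]⟩

/-! ### The variety of an intersection -/

theorem mem_variety_iff {A : BFrame.{u}} :
    A ∈ L.variety.members ↔ ∀ φ ∈ L.theorems, ∀ e : ℕ → A.carrier, φ.eval A.op e = ⊤ := by
  constructor
  · intro h φ hφ e
    simpa using h (φ, .top) ⟨φ, hφ, rfl⟩ e
  · rintro h _ ⟨φ, hφ, rfl⟩ e
    simpa using h φ hφ e

theorem Separated.inf_value_eq (h : Separated k L₁ L₂) {A : BFrame.{u}}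
    (hA : A ∈ (L₁.inter L₂).variety.members) (hφ : φ ∈ L₁.theorems) (e : ℕ → A.carrier) :
    φ.eval A.op e ⊓ A.value k = A.value k := by
  have := mem_variety_iff.1 hA _ (h.imp_mem_inter_iff.2 hφ) e
  rw [BTerm.eval_imp, BFrame.eval_ground, sup_comm, ← himp_eq, himp_eq_top_iff] at this
  exact inf_eq_right.2 this

theorem Separated.isFactor (h : Separated k L₁ L₂) {A : BFrame.{u}}
    (hA : A ∈ (L₁.inter L₂).variety.members) : A.IsFactor (A.value k) := by
  intro x
  -- the instance of localization at the variable `0`, in the form of an equation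
  have := mem_variety_iff.1 hA
    ((BTerm.inf (.op (.inf (.var 0) k.ground)) k.ground).iff (.inf (.op (.var 0)) k.ground))
    (mem_of_tautology (fun w hb hc hi => by
      simp only [BTerm.imp, BTerm.iff, hc, hi]; tauto) (h.localizes (.var 0))) fun _ => x
  rw [BTerm.eval_iff_eq_top] at this
  simpa [BFrame.eval_ground] using this

theorem Separated.relativize_mem (h : Separated k L₁ L₂) {A : BFrame.{u}}
    (hA : A ∈ (L₁.inter L₂).variety.members) :
    A.relativize (A.value k) ∈ L₁.variety.members := by
  rintro _ ⟨φ, hφ, rfl⟩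
  refine ((h.isFactor hA).satisfies_iff _).2 fun e => ?_
  simp [h.inf_value_eq hA hφ]

theorem variety_anti (h : L₁.theorems ⊆ L₂.theorems) :
    L₂.variety.{u} ≤ L₁.variety := by
  intro A hA
  exact mem_variety_iff.2 fun φ hφ => mem_variety_iff.1 hA φ (h hφ)

theorem Separated.variety_inter (h : Separated k L₁ L₂) :
    (L₁.inter L₂).variety.{u} = L₁.variety ⊔ L₂.variety := by
  refine le_antisymm (fun A hA => ?_)
    (sup_le (variety_anti Set.inter_subset_left) (variety_anti Set.inter_subset_right))
  have hA' : A ∈ (L₂.inter L₁).variety.members := by rwa [inter_comm]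
  exact Variety.mem_sup_of_relativize (h.isFactor hA) (h.symm.isFactor hA') (h.relativize_mem hA)
    (h.symm.relativize_mem hA')

/-! ### The logic of a Boolean frame -/

/-- Tautologies have the value `1` in every Boolean frame: an element different from `1` is
separated from `1` by a prime ideal, that is, by a two-valued valuation. -/
theorem _root_.BF.IsTautology.eval_eq_top {φ : Form} (h : IsTautology φ) (A : BFrame.{u})
    (e : ℕ → A.carrier) : φ.eval A.op e = ⊤ := by
  by_contra hne
  obtain ⟨J, hJ, hle, -⟩ := DistribLattice.prime_ideal_of_disjoint_filter_ideal
    (F := Order.PFilter.principal (⊤ : A.carrier)) (I := Order.Ideal.principal (φ.eval A.op e)) (by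
      rw [Set.disjoint_left]
      intro x hx hx'
      exact hne (top_le_iff.1 ((Order.PFilter.mem_principal.1 hx).trans
        (Order.Ideal.mem_principal.1 hx'))))
  refine h (fun α => α.eval A.op e ∉ J) (fun H => H J.bot_mem) (fun α => ?_) (fun α β => ?_)
    (hle (Order.Ideal.mem_principal.2 le_rfl))
  · refine not_congr ⟨fun H H' => ?_, fun H => (hJ.mem_or_compl_mem).resolve_left H⟩
    have := J.sup_mem H' H
    rw [BTerm.eval_compl, sup_compl_eq_top] at this
    exact hJ.toIsProper.top_notMem this
  · rw [BTerm.eval_inf, ← not_or]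
    exact not_congr ⟨hJ.mem_or_mem, fun H => H.elim (J.lower inf_le_left) (J.lower inf_le_right)⟩

/-- The logic of all formulas valid in a Boolean frame. -/
def ofFrame (P : BFrame.{v}) : CongruentialLogic where
  theorems := {φ | ∀ e : ℕ → P.carrier, φ.eval P.op e = ⊤}
  tautology φ h := h.eval_eq_top P
  modusPonens φ ψ h h' e := by simpa [h e] using h' e
  congruence φ ψ h e := by
    have := (BTerm.eval_iff_eq_top _ _ _ _).1 (h e)
    rw [BTerm.eval_iff_eq_top, BTerm.eval_op, BTerm.eval_op, this]
  substitution φ σ h e := by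
    rw [BTerm.eval_subst]
    exact h _

/-- An equation `s = t` is valid just in case the formula `s ↔ t` is, so the variety of the logic of
`P` is the variety generated by `P`. -/
theorem variety_ofFrame (P : BFrame.{v}) :
    (ofFrame P).variety.{u} = Variety.generatedBy P := by
  refine le_antisymm (fun A hA => Variety.mem_generatedBy_iff.2 fun p hp e => ?_) fun A hA => ?_
  · exact (BTerm.eval_iff_eq_top _ _ _ _).1 (mem_variety_iff.1 hA (p.1.iff p.2)
      (fun e => (BTerm.eval_iff_eq_top _ _ _ _).2 (hp e)) e)
  · rintro _ ⟨φ, hφ, rfl⟩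
    exact Variety.mem_generatedBy_iff.1 hA _ fun e => by simpa using hφ e

/-- If `d` is a unary discriminator on `P`, then `□p = ¬ d(¬ p)` expresses that `p` has the value
`1`, and `□p → q` is a deduction formula for the logic of `P`. -/
theorem ddt_ofFrame {P : BFrame.{v}} {d : BTerm Unit} (hd : IsUnaryDiscriminator P d) :
    (ofFrame P).DDT := by
  let box {X : Type} (t : BTerm X) : BTerm X := (d.app t.compl).compl
  have box_eval (t : Form) (e : ℕ → P.carrier) :
      (box t).eval P.op e = ⊥ ∨ t.eval P.op e = ⊤ ∧ (box t).eval P.op e = ⊤ := by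
    by_cases ht : t.eval P.op e = ⊤
    · exact Or.inr ⟨ht, by simp [box, ht, hd.bot]⟩
    · refine Or.inl ?_
      simp [box, hd.eq_top (t.eval P.op e)ᶜ fun H => ht (compl_eq_bot.1 H)]
  have box_le (t : Form) : (box t).imp t ∈ (ofFrame P).theorems := by
    intro e
    rcases box_eval t e with H | ⟨H, -⟩ <;> simp [H]
  have box_localizes (t : Form) : (ofFrame P).Localizes (box t) := by
    intro α e
    rcases box_eval t e with H | ⟨-, H⟩
    · simp [H]
    · rw [BTerm.eval_imp, (BTerm.eval_iff_eq_top _ _ _ _).2 (by simp [H]), sup_top_eq]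
  have derives_box {Γ : Set Form} {φ : Form} (h : (ofFrame P).Derives Γ φ) :
      (ofFrame P).Derives Γ (box φ) := by
    -- formulas equivalent under `Γ` have equivalent substitution instances in every term
    have replace (t : BTerm Unit) {α β : Form} (hαβ : (ofFrame P).Derives Γ (α.iff β)) :
        (ofFrame P).Derives Γ ((t.app α).iff (t.app β)) := by
      unfold BTerm.app
      induction t with
      | var x => exact hαβ
      | bot =>
        refine .thm ((ofFrame P).tautology _ fun w hb hc hi => ?_)
        simp only [BTerm.imp, BTerm.iff, hc, hi]
        tauto
      | compl s ih =>
        refine ih.of_tautology fun w hb hc hi => ?_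
        simp only [BTerm.imp, BTerm.iff, BTerm.subst, hc, hi]
        tauto
      | inf s t ih₁ ih₂ =>
        refine .of_tautology₂ (fun w hb hc hi => ?_) ih₁ ih₂
        simp only [BTerm.imp, BTerm.iff, BTerm.subst, hc, hi]
        tauto
      | op s ih => exact ih.re
    have h₁ : (ofFrame P).Derives Γ (BTerm.bot.iff φ.compl) := by
      refine h.of_tautology fun w hb hc hi => ?_
      simp only [BTerm.imp, BTerm.iff, hc, hi]
      tauto
    have h₂ : (d.app .bot).compl ∈ (ofFrame P).theorems := fun e => by simp [hd.bot]
    refine .of_tautology₂ (fun w hb hc hi => ?_) (.thm h₂) (replace d h₁)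
    simp only [box, BTerm.imp, BTerm.iff, hc, hi]
    tauto
  refine ⟨{(box (.var 0)).imp (.var 1)}, fun Γ φ ψ => ?_⟩
  have subst_box (ψ : Form) : ((box (.var 0)).imp (.var 1) : BTerm (Fin 2)).subst ![φ, ψ] =
      (box φ).imp ψ := by
    simp only [box, BTerm.imp, BTerm.subst, BTerm.subst_app]
    rfl
  simp only [Finset.mem_singleton, forall_eq, subst_box]
  constructor
  · intro H
    induction H with
    | thm H =>
      refine .of_tautology (fun w hb hc hi => ?_) (.thm H)
      simp only [BTerm.imp, hc, hi]
      tauto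
    | hyp H =>
      rcases H with rfl | H
      · exact .thm (box_le _)
      · refine .of_tautology (fun w hb hc hi => ?_) (.hyp H)
        simp only [BTerm.imp, hc, hi]
        tauto
    | mp _ _ ih₁ ih₂ =>
      refine .of_tautology₂ (fun w hb hc hi => ?_) ih₁ ih₂
      simp only [BTerm.imp, hc, hi]
      tauto
    | re _ ih => exact ih.imp_re (box_localizes φ)
  · intro H
    exact .mp (derives_box (.hyp (Set.mem_insert φ Γ))) H.weaken

end CongruentialLogic

/-! ### The embedding given by a frame with a unary discriminator -/

/-- A copy of `P` in a larger universe. -/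
def BFrame.lift (P : BFrame.{v}) : BFrame.{max u v} where
  carrier := ULift.{u} P.carrier
  boolean := Equiv.ulift.booleanAlgebra
  op x := ⟨P.op x.down⟩

theorem BFrame.down_eval_lift (P : BFrame.{v}) {X : Type} (e : X → (BFrame.lift.{u} P).carrier)
    (t : BTerm X) :
    (t.eval (BFrame.lift.{u} P).op e).down = t.eval P.op fun x => (e x).down :=
  BTerm.map_eval _ e P.op ULift.down rfl (fun _ => rfl) (fun _ _ => rfl) (fun _ => rfl) t

theorem BFrame.lift_mem_generatedBy (P : BFrame.{0}) :
    BFrame.lift.{u} P ∈ (Variety.generatedBy.{u} P).members := by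
  refine Variety.mem_generatedBy_iff.2 fun p hp e => ULift.down_injective ?_
  rw [BFrame.down_eval_lift, BFrame.down_eval_lift]
  exact hp _

theorem BFrame.EquivalentToAdditive.of_lift {P : BFrame.{0}}
    (h : (BFrame.lift.{u} P).EquivalentToAdditive) : P.EquivalentToAdditive := by
  obtain ⟨g, hg, ⟨σ, hσ⟩, τ, hτ⟩ := h
  refine ⟨fun x => (g ⟨x⟩).down, fun x y => congrArg ULift.down (hg ⟨x⟩ ⟨y⟩), ⟨σ, fun x => ?_⟩, τ,
    fun x => ?_⟩
  · exact (P.down_eval_lift (fun _ => ⟨x⟩) σ).symm.trans (congrArg ULift.down (hσ ⟨x⟩))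
  · have := congrArg ULift.down (hτ ⟨x⟩)
    rw [BTerm.map_eval (A := (BFrame.lift.{u} P).carrier) g (fun _ => ⟨x⟩)
      (fun x => (g ⟨x⟩).down) ULift.down rfl (fun _ => rfl)
      (fun _ _ => rfl) (fun _ => rfl) τ] at this
    exact this

theorem Variety.stronglyNonAdditive_sup_generatedBy {P : BFrame.{0}}
    (hP : ¬ P.EquivalentToAdditive) (W : Variety.{u}) :
    (W ⊔ Variety.generatedBy P).StronglyNonAdditive :=
  fun h => hP (h _ (le_sup_right (a := W) P.lift_mem_generatedBy)).of_lift

/-- The embedding theorem for a class of varieties and logics that is defined by a ground term `k`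
having the value `1`, and a frame with a unary discriminator in which `k` has the value `0`. -/
theorem exists_embedding {P : BFrame.{0}} {d : BTerm Unit} {k : BTerm Empty}
    (hd : IsUnaryDiscriminator P d) (hna : ¬ P.EquivalentToAdditive) (hk : P.value k = ⊥)
    {N : Variety.{u}} (hN : ∀ A ∈ N.members, A.value k = ⊤)
    {good : CongruentialLogic → Prop} (hgood : ∀ L, good L → k.ground ∈ L.theorems) :
    (∃ T : LatticeHom (Set.Iic N) Variety.{u},
      (∀ W, T W = W.1 ⊔ Variety.generatedBy P) ∧
      Function.Injective T ∧
      ∀ W, (T W).StronglyNonAdditive ∧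
        (W.1.CEP → (T W).CEP) ∧
        (W.1.EDPC → (T W).EDPC) ∧
        (W.1.IsDiscriminator → (T W).IsDiscriminator)) ∧
    (∃ R : {L : CongruentialLogic // good L} → CongruentialLogic,
      Function.Injective R ∧
      ∀ L, (R L).theorems ⊆ L.1.theorems ∧
        (R L).variety = L.1.variety ⊔ Variety.generatedBy.{u} P ∧
        (R L).variety.StronglyNonAdditive.{u} ∧
        (L.1.LDDT → (R L).LDDT) ∧
        (L.1.DDT → (R L).DDT)) := by
  have hsep (W : Set.Iic N) : Variety.Separated k W.1 (Variety.generatedBy P) := by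
    refine ⟨fun A hA => hN A (W.2 hA), fun A hA => ?_⟩
    have := Variety.mem_generatedBy_iff.1 hA (k.ground, .bot)
      (fun e => by simp [BFrame.eval_ground, hk]) fun _ => ⊥
    simpa [BFrame.eval_ground] using this
  have hlog (L : {L : CongruentialLogic // good L}) :
      CongruentialLogic.Separated k L.1 (CongruentialLogic.ofFrame P) :=
    ⟨hgood L.1 L.2, fun e => by simp [BFrame.eval_ground, hk]⟩
  have hvar (L : {L : CongruentialLogic // good L}) :
      (L.1.inter (CongruentialLogic.ofFrame P)).variety.{u} =
        L.1.variety ⊔ Variety.generatedBy P := by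
    rw [(hlog L).variety_inter, CongruentialLogic.variety_ofFrame]
  refine ⟨⟨{ toFun := fun W => W.1 ⊔ Variety.generatedBy P
             map_sup' := fun W W' => sup_sup_distrib_right W.1 W'.1 _
             map_inf' := fun W W' => (hsep W).inf_sup (hsep W') }, fun W => rfl, ?_, fun W => ?_⟩,
    fun L => L.1.inter (CongruentialLogic.ofFrame P), fun L L' hLL' => ?_, fun L => ?_⟩
  · intro W W' hWW'
    exact Subtype.ext (le_antisymm ((hsep W).le_of_sup_le (hsep W') (le_of_eq hWW'))
      ((hsep W').le_of_sup_le (hsep W) (ge_of_eq hWW')))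
  · exact ⟨Variety.stronglyNonAdditive_sup_generatedBy hna W.1, fun h => (hsep W).cep h hd.cep,
      fun h => (hsep W).edpc h hd.edpc, fun h => (hsep W).isDiscriminator h hd.isDiscriminator⟩
  · refine Subtype.ext (CongruentialLogic.theorems_injective (Set.ext fun φ => ?_))
    rw [← (hlog L).imp_mem_inter_iff, ← (hlog L').imp_mem_inter_iff]
    exact iff_of_eq (congrArg (fun M : CongruentialLogic => k.ground.imp φ ∈ M.theorems) hLL')
  · have hddt := CongruentialLogic.ddt_ofFrame hd
    refine ⟨Set.inter_subset_left, hvar L, ?_, fun h => (hlog L).lddt h hddt.lddt,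
      fun h => (hlog L).ddt h hddt⟩
    rw [hvar L]
    exact Variety.stronglyNonAdditive_sup_generatedBy hna _

/-! ### Non-additivity of operations on a power set -/

/-- If `f` does not preserve `{0, 1}`, and for no `i` respects agreement on membership of `i`, then
`f` is not a term operation of any additive operation. -/
theorem not_equivalentToAdditive {n : ℕ} (f : Finset (Fin n) → Finset (Fin n))
    (h₁ : ¬ ((f ∅ = ∅ ∨ f ∅ = Finset.univ) ∧ (f Finset.univ = ∅ ∨ f Finset.univ = Finset.univ)))
    (h₂ : ∀ i, ∃ x y, (i ∈ x ↔ i ∈ y) ∧ ¬ (i ∈ f x ↔ i ∈ f y)) :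
    ¬ (BFrame.mk (Finset (Fin n)) f).EquivalentToAdditive := by
  rintro ⟨g, hg, -, τ, hτ⟩
  -- if membership of `i` in `g x` did not depend on `x`, it would define a congruence of `g`
  have hdep (i : Fin n) : ∃ x y, ¬ (i ∈ g x ↔ i ∈ g y) := by
    by_contra H
    push Not at H
    have hcong (t : BTerm Unit) (x y : Finset (Fin n)) (hxy : i ∈ x ↔ i ∈ y) :
        i ∈ t.eval g (fun _ => x) ↔ i ∈ t.eval g (fun _ => y) := by
      induction t with
      | var _ => exact hxy
      | bot => exact Iff.rfl
      | compl s ih => simpa using not_congr ih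
      | inf s t ih₁ ih₂ => simpa using and_congr ih₁ ih₂
      | op s ih => exact H _ _
    obtain ⟨x, y, hxy, hne⟩ := h₂ i
    have := hcong τ x y hxy
    rw [hτ, hτ] at this
    exact hne this
  have mono (x y : Finset (Fin n)) (hxy : x ⊆ y) : g x ⊆ g y := by
    have := hg x y
    rw [sup_eq_right.2 hxy] at this
    rw [this]
    exact le_sup_left
  have g_bot : g ∅ = ∅ := by
    refine Finset.eq_empty_of_forall_notMem fun i hi => ?_
    obtain ⟨x, y, hne⟩ := hdep i
    exact hne (iff_of_true (mono _ _ (Finset.empty_subset x) hi)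
      (mono _ _ (Finset.empty_subset y) hi))
  have g_top : g Finset.univ = Finset.univ := by
    refine Finset.eq_univ_of_forall fun i => ?_
    by_contra hi
    obtain ⟨x, y, hne⟩ := hdep i
    exact hne (iff_of_false (fun H => hi (mono _ _ (Finset.subset_univ x) H))
      fun H => hi (mono _ _ (Finset.subset_univ y) H))
  -- hence `{0, 1}` is a subalgebra with respect to `g`
  have hsub (t : BTerm Unit) (x : Finset (Fin n)) (hx : x = ∅ ∨ x = Finset.univ) :
      t.eval g (fun _ => x) = ∅ ∨ t.eval g (fun _ => x) = Finset.univ := by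
    induction t with
    | var _ => exact hx
    | bot => exact Or.inl rfl
    | compl s ih => rcases ih with ih | ih <;> simp [ih]
    | inf s t ih₁ ih₂ => rcases ih₁ with ih₁ | ih₁ <;> rcases ih₂ with ih₂ | ih₂ <;> simp [ih₁, ih₂]
    | op s ih => rcases ih with ih | ih <;> simp [ih, g_bot, g_top]
  refine h₁ ⟨?_, ?_⟩
  · have := hsub τ ∅ (Or.inl rfl)
    rwa [hτ] at this
  · have := hsub τ Finset.univ (Or.inr rfl)
    rwa [hτ] at this

/-! ### Unary discriminators on a power set -/

/-- `F` is a unary term operation of the power set algebra with the operation `f`. -/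
def IsTermOp {n : ℕ} (f F : Finset (Fin n) → Finset (Fin n)) : Prop :=
  ∃ t : BTerm Unit, ∀ x, t.eval f (fun _ => x) = F x

namespace IsTermOp

variable {n : ℕ} {f F G : Finset (Fin n) → Finset (Fin n)}

theorem id : IsTermOp f fun x => x := ⟨.var (), fun _ => rfl⟩

theorem bot : IsTermOp f fun _ => ∅ := ⟨.bot, fun _ => rfl⟩

theorem compl : IsTermOp f F → IsTermOp f fun x => (F x)ᶜ
  | ⟨t, ht⟩ => ⟨t.compl, fun x => by simp [ht]⟩

theorem inter : IsTermOp f F → IsTermOp f G → IsTermOp f fun x => F x ∩ G x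
  | ⟨s, hs⟩, ⟨t, ht⟩ => ⟨s.inf t, fun x => by simp [hs, ht]⟩

theorem union : IsTermOp f F → IsTermOp f G → IsTermOp f fun x => F x ∪ G x
  | ⟨s, hs⟩, ⟨t, ht⟩ => ⟨s.sup t, fun x => by simp [hs, ht]⟩

theorem op : IsTermOp f F → IsTermOp f fun x => f (F x)
  | ⟨t, ht⟩ => ⟨t.op, fun x => by simp [ht]⟩

theorem comp : IsTermOp f F → IsTermOp f G → IsTermOp f fun x => F (G x)
  | ⟨s, hs⟩, ⟨t, ht⟩ => ⟨s.subst fun _ => t, fun x => by simp [hs, ht]⟩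

theorem congr (hF : IsTermOp f F) (h : ∀ x, F x = G x) : IsTermOp f G := by
  rwa [← funext h]

end IsTermOp

/-- The two-valued test for membership of `i`. -/
def memTest {n : ℕ} (i : Fin n) (x : Finset (Fin n)) : Finset (Fin n) :=
  if i ∈ x then Finset.univ else ∅

/-- A unary discriminator is the union of the membership tests. -/
theorem exists_isUnaryDiscriminator {n : ℕ} {f : Finset (Fin n) → Finset (Fin n)}
    (h : ∀ i, IsTermOp f (memTest i)) :
    ∃ d : BTerm Unit, IsUnaryDiscriminator (BFrame.mk (Finset (Fin n)) f) d := by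
  have key (s : Finset (Fin n)) :
      IsTermOp f fun x => if ∃ i ∈ s, i ∈ x then Finset.univ else ∅ := by
    induction s using Finset.induction_on with
    | empty => exact IsTermOp.bot.congr fun x => by simp
    | insert i s his ih =>
      refine ((h i).union ih).congr fun x => ?_
      by_cases hi : i ∈ x <;> simp [memTest, hi]
  obtain ⟨d, hd⟩ := key Finset.univ
  refine ⟨d, (hd ∅).trans (by simp), fun x hx => (hd x).trans (if_pos ?_)⟩
  obtain ⟨i, hi⟩ := Finset.nonempty_iff_ne_empty.2 hx
  exact ⟨i, Finset.mem_univ i, hi⟩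

/-! ### The cyclic-shift algebras -/

section cyclic

variable {n : ℕ}

theorem cyclicOp_empty : cyclicOp n ∅ = Finset.univ := if_pos rfl

theorem singleton_ne_univ (hn : 2 ≤ n) (i : Fin n) : ({i} : Finset (Fin n)) ≠ Finset.univ := by
  intro h
  have := congrArg Finset.card h
  simp at this
  omega

theorem univ_ne_empty (hn : 1 ≤ n) : (Finset.univ : Finset (Fin n)) ≠ ∅ := by
  intro h
  have := congrArg Finset.card h
  simp at this
  omega

theorem mem_cyclicOp_univ (hn : 1 ≤ n) (j : Fin n) :
    j ∈ cyclicOp n Finset.univ ↔ j.val + 1 = n := by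
  simp [cyclicOp, univ_ne_empty hn]

theorem mem_cyclicOp_singleton (hn : 2 ≤ n) (i j : Fin n) :
    j ∈ cyclicOp n {i} ↔ j.val + 1 = i.val := by
  simp [cyclicOp, singleton_ne_univ hn]

/-- `{i}` is obtained from `∅` by iterating `f`. -/
theorem isTermOp_cyclicOp_singleton (hn : 2 ≤ n) (i : Fin n) :
    IsTermOp (cyclicOp n) fun _ => {i} := by
  obtain ⟨m, hm⟩ : ∃ m, m + i.val + 1 = n := ⟨n - 1 - i.val, by omega⟩
  induction m generalizing i with
  | zero =>
    refine IsTermOp.bot.op.op.congr fun _ => ?_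
    ext j
    rw [cyclicOp_empty, mem_cyclicOp_univ (by omega), Finset.mem_singleton, Fin.ext_iff]
    omega
  | succ m ih =>
    refine (ih ⟨i.val + 1, by omega⟩ (by simp only; omega)).op.congr fun _ => ?_
    ext j
    rw [mem_cyclicOp_singleton hn, Finset.mem_singleton, Fin.ext_iff]
    simp

theorem isTermOp_cyclicOp_memTest (hn : 3 ≤ n) (i : Fin n) :
    IsTermOp (cyclicOp n) (memTest i) := by
  have hinter (i : Fin n) (x : Finset (Fin n)) :
      {i} ∩ x = if i ∈ x then {i} else ∅ := Finset.singleton_inter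
  have hmeet (i : Fin n) : IsTermOp (cyclicOp n) fun x => (cyclicOp n ({i} ∩ x))ᶜ :=
    ((isTermOp_cyclicOp_singleton (by omega) i).inter .id).op.compl
  -- if the predecessor of `i` is not `j`, then `j` belongs to `¬ f({i} ∩ x)` just in case `i ∈ x`
  have hstep (i j : Fin n) (hij : j.val + 1 ≠ i.val) (hj : IsTermOp (cyclicOp n) (memTest j)) :
      IsTermOp (cyclicOp n) (memTest i) := by
    refine (hj.comp (hmeet i)).congr fun x => ?_
    simp only [memTest, hinter, Finset.mem_compl]
    by_cases hi : i ∈ x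
    · simp [hi, mem_cyclicOp_singleton (show 2 ≤ n by omega), hij]
    · simp [hi, cyclicOp_empty]
  -- `f` maps `{0}` to `∅` and `∅` to `1`, so `¬ f({0} ∩ x)` is the test for `0`
  have h0 : IsTermOp (cyclicOp n) (memTest ⟨0, by omega⟩) := by
    refine (hmeet ⟨0, by omega⟩).congr fun x => ?_
    ext j
    by_cases hx : (⟨0, by omega⟩ : Fin n) ∈ x
    · simp [memTest, hx, hinter, mem_cyclicOp_singleton (show 2 ≤ n by omega)]
    · simp [memTest, hx, hinter, cyclicOp_empty]
  -- the predecessor of `1` is `0`, so the test for `1` goes through the one for `2`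
  by_cases hi : i.val = 1
  · exact hstep i ⟨2, by omega⟩ (by simp [hi]) (hstep ⟨2, by omega⟩ ⟨0, by omega⟩ (by simp) h0)
  · exact hstep i ⟨0, by omega⟩ (by simp; omega) h0

theorem not_equivalentToAdditive_cyclicFrame (hn : 3 ≤ n) :
    ¬ (cyclicFrame n).EquivalentToAdditive := by
  refine not_equivalentToAdditive (cyclicOp n) ?_ fun i => ?_
  · rintro ⟨-, h | h⟩
    · have := (mem_cyclicOp_univ (show 1 ≤ n by omega) ⟨n - 1, by omega⟩).2 (by simp; omega)
      rw [h] at this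
      simp at this
    · have := (mem_cyclicOp_univ (show 1 ≤ n by omega) ⟨0, by omega⟩).1 (h ▸ Finset.mem_univ _)
      simp at this
      omega
  · -- an index `j` different from `i` and from its successor
    obtain ⟨j, hj, hj'⟩ : ∃ j : Fin n, j.val ≠ i.val ∧ i.val + 1 ≠ j.val := by
      by_cases hi : i.val = 0
      · exact ⟨⟨2, by omega⟩, by simp [hi], by simp [hi]⟩
      · exact ⟨⟨0, by omega⟩, by simp; omega, by simp⟩
    refine ⟨∅, {j}, ?_, ?_⟩
    · simp [Fin.ext_iff, hj.symm]
    · simp [cyclicOp_empty, mem_cyclicOp_singleton (show 2 ≤ n by omega), hj']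

theorem mem_reversedCyclicOp_empty (j : Fin n) : j ∈ reversedCyclicOp n ∅ ↔ j.val = 0 := by
  simp [reversedCyclicOp]

theorem reversedCyclicOp_univ (hn : 1 ≤ n) : reversedCyclicOp n Finset.univ = ∅ := by
  simp [reversedCyclicOp, univ_ne_empty hn]

theorem reversedCyclicOp_singleton_last (hn : 2 ≤ n) {i : Fin n} (hi : i.val + 1 = n) :
    reversedCyclicOp n {i} = Finset.univ := by
  simp [reversedCyclicOp, singleton_ne_univ hn, hi]

theorem mem_reversedCyclicOp_singleton (hn : 2 ≤ n) {i : Fin n} (hi : i.val + 1 ≠ n) (j : Fin n) :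
    j ∈ reversedCyclicOp n {i} ↔ j.val = i.val + 1 := by
  simp [reversedCyclicOp, singleton_ne_univ hn, hi]

theorem reversedCyclicOp_compl_singleton (hn : 3 ≤ n) (i : Fin n) :
    reversedCyclicOp n {i}ᶜ = {i}ᶜ := by
  have hcard : ({i}ᶜ : Finset (Fin n)).card = n - 1 := by simp [Finset.card_compl]
  have h₁ : ({i}ᶜ : Finset (Fin n)) ≠ ∅ := by
    intro h
    rw [h, Finset.card_empty] at hcard
    omega
  have h₂ : ({i}ᶜ : Finset (Fin n)) ≠ Finset.univ := by
    intro h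
    rw [h, Finset.card_univ, Fintype.card_fin] at hcard
    omega
  rw [reversedCyclicOp, if_neg h₁, if_neg h₂, if_neg (by omega)]

/-- `{i}` is obtained from `∅` by iterating `f`. -/
theorem isTermOp_reversedCyclicOp_singleton (hn : 2 ≤ n) (i : Fin n) :
    IsTermOp (reversedCyclicOp n) fun _ => {i} := by
  obtain ⟨m, hm⟩ : ∃ m, i.val = m := ⟨_, rfl⟩
  induction m generalizing i with
  | zero =>
    refine IsTermOp.bot.op.congr fun _ => ?_
    ext j
    rw [mem_reversedCyclicOp_empty, Finset.mem_singleton, Fin.ext_iff, hm]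
  | succ m ih =>
    refine (ih ⟨m, by omega⟩ rfl).op.congr fun _ => ?_
    ext j
    rw [mem_reversedCyclicOp_singleton hn (by simp only; omega), Finset.mem_singleton,
      Fin.ext_iff, hm]

theorem isTermOp_reversedCyclicOp_memTest (hn : 3 ≤ n) (i : Fin n) :
    IsTermOp (reversedCyclicOp n) (memTest i) := by
  have hinter (i : Fin n) (x : Finset (Fin n)) :
      {i} ∩ x = if i ∈ x then {i} else ∅ := Finset.singleton_inter
  have hmeet (i : Fin n) : IsTermOp (reversedCyclicOp n) fun x => reversedCyclicOp n ({i} ∩ x) :=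
    ((isTermOp_reversedCyclicOp_singleton (by omega) i).inter .id).op
  have hempty : reversedCyclicOp n ∅ = {⟨0, by omega⟩} := by
    ext j
    rw [mem_reversedCyclicOp_empty, Finset.mem_singleton, Fin.ext_iff]
  obtain ⟨m, hm⟩ : ∃ m, m + i.val + 1 = n := ⟨n - 1 - i.val, by omega⟩
  induction m generalizing i with
  | zero =>
    -- with `y = f({i} ∩ x)`, which is `1` if `i ∈ x` and `{0}` otherwise, the set `y ∩ f(¬ y)`
    -- is `{0}` if `i ∈ x` and `∅` otherwise, because `f` fixes the complement of `{0}`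
    have h0 := isTermOp_reversedCyclicOp_singleton (show 2 ≤ n by omega) ⟨0, by omega⟩
    refine (((hmeet i).inter (hmeet i).compl.op).union ((hmeet i).inter h0.compl)).congr fun x => ?_
    by_cases hi : i ∈ x
    · simp [memTest, hinter, hi, hempty,
        reversedCyclicOp_singleton_last (show 2 ≤ n by omega) (show i.val + 1 = n by omega)]
    · simp [memTest, hinter, hi, hempty, reversedCyclicOp_compl_singleton hn]
  | succ m ih =>
    -- the successor of `i` belongs to `f({i} ∩ x)` just in case `i ∈ x`
    refine ((ih ⟨i.val + 1, by omega⟩ (by simp only; omega)).comp (hmeet i)).congr fun x => ?_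
    simp only [memTest, hinter]
    by_cases hi : i ∈ x
    · simp [hi, mem_reversedCyclicOp_singleton (show 2 ≤ n by omega) (show i.val + 1 ≠ n by omega)]
    · simp [hi, mem_reversedCyclicOp_empty]

theorem not_equivalentToAdditive_reversedCyclicFrame (hn : 3 ≤ n) :
    ¬ (reversedCyclicFrame n).EquivalentToAdditive := by
  refine not_equivalentToAdditive (reversedCyclicOp n) ?_ fun i => ?_
  · rintro ⟨h | h, -⟩
    · have := (mem_reversedCyclicOp_empty (⟨0, by omega⟩ : Fin n)).2 rfl
      rw [h] at this
      simp at this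
    · have := (mem_reversedCyclicOp_empty (⟨1, by omega⟩ : Fin n)).1 (h ▸ Finset.mem_univ _)
      simp at this
  · by_cases hi : i.val = 0
    · refine ⟨∅, {⟨1, by omega⟩}, ?_, ?_⟩
      · simp [Fin.ext_iff, hi]
      · rw [mem_reversedCyclicOp_empty,
          mem_reversedCyclicOp_singleton (by omega) (by simp only; omega)]
        simp [hi]
    · refine ⟨∅, {⟨i.val - 1, by omega⟩}, ?_, ?_⟩
      · simp [Fin.ext_iff]
        omega
      · rw [mem_reversedCyclicOp_empty,
          mem_reversedCyclicOp_singleton (by omega) (by simp only; omega)]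
        simp only
        omega

end cyclic

end BF

theorem mainTheorem2 (n : ℕ) (hn : 3 ≤ n) :
    -- normal varieties and normal logics
    ((∃ T : LatticeHom (Set.Iic BF.Variety.normal.{u}) BF.Variety.{u},
        (∀ W, T W = W.1 ⊔ BF.Variety.generatedBy (BF.cyclicFrame n)) ∧
        Function.Injective T ∧
        ∀ W, (T W).StronglyNonAdditive ∧
          (W.1.CEP → (T W).CEP) ∧
          (W.1.EDPC → (T W).EDPC) ∧
          (W.1.IsDiscriminator → (T W).IsDiscriminator)) ∧
      (∃ R : {L : BF.CongruentialLogic // L.IsNormal} → BF.CongruentialLogic,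
        Function.Injective R ∧
        ∀ L, (R L).theorems ⊆ L.1.theorems ∧
          (R L).variety = L.1.variety ⊔ BF.Variety.generatedBy.{u} (BF.cyclicFrame n) ∧
          (R L).variety.StronglyNonAdditive.{u} ∧
          (L.1.LDDT → (R L).LDDT) ∧
          (L.1.DDT → (R L).DDT))) ∧
    -- varieties and logics with `f(1) = 1`
    ((∃ T : LatticeHom (Set.Iic BF.Variety.unital.{u}) BF.Variety.{u},
        (∀ W, T W = W.1 ⊔ BF.Variety.generatedBy (BF.reversedCyclicFrame n)) ∧
        Function.Injective T ∧
        ∀ W, (T W).StronglyNonAdditive ∧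
          (W.1.CEP → (T W).CEP) ∧
          (W.1.EDPC → (T W).EDPC) ∧
          (W.1.IsDiscriminator → (T W).IsDiscriminator)) ∧
      (∃ R : {L : BF.CongruentialLogic // L.IsUnital} → BF.CongruentialLogic,
        Function.Injective R ∧
        ∀ L, (R L).theorems ⊆ L.1.theorems ∧
          (R L).variety = L.1.variety ⊔ BF.Variety.generatedBy.{u} (BF.reversedCyclicFrame n) ∧
          (R L).variety.StronglyNonAdditive.{u} ∧
          (L.1.LDDT → (R L).LDDT) ∧
          (L.1.DDT → (R L).DDT))) := by
  obtain ⟨d, hd⟩ := BF.exists_isUnaryDiscriminator (BF.isTermOp_cyclicOp_memTest hn)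
  obtain ⟨d', hd'⟩ := BF.exists_isUnaryDiscriminator (BF.isTermOp_reversedCyclicOp_memTest hn)
  constructor
  · -- the separating ground term is `¬ f(0)`
    refine BF.exists_embedding (k := .compl (.op .bot)) hd
      (BF.not_equivalentToAdditive_cyclicFrame hn) ?_ (fun A hA => ?_) fun L hL => ?_
    · change (BF.cyclicOp n ∅)ᶜ = ∅
      simp [BF.cyclicOp_empty]
    · have : A.op ⊥ = ⊥ := hA _ rfl fun _ => ⊥
      simp [BF.BFrame.value, this]
    · refine BF.CongruentialLogic.mem_of_tautology (fun w hb hc hi => ?_) hL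
      simp only [BF.BTerm.ground, BF.BTerm.subst, BF.BTerm.imp, BF.BTerm.iff, hc, hi]
      tauto
  · -- the separating ground term is `f(1)`
    refine BF.exists_embedding (k := .op .top) hd'
      (BF.not_equivalentToAdditive_reversedCyclicFrame hn) ?_ (fun A hA => ?_) fun L hL => ?_
    · change BF.reversedCyclicOp n ∅ᶜ = ∅
      simp [BF.reversedCyclicOp_univ (show 1 ≤ n by omega)]
    · have : A.op ⊥ᶜ = ⊥ᶜ := hA _ rfl fun _ => ⊥
      simpa [BF.BFrame.value] using this
    · refine BF.CongruentialLogic.mem_of_tautology (fun w hb hc hi => ?_) hL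
      simp only [BF.BTerm.ground, BF.BTerm.subst, BF.BTerm.top, BF.BTerm.imp, BF.BTerm.iff, hc, hi]
      tauto
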